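/- Let $\Sigma$ be a compact hyperbolic surface with geodesic boundary, and let $S(\Sigma)$ be its unit tangent bundle. A geodesic path is a unit speed geodesic $[a,b]\to\Sigma$. **Graph of a vector.** For $v\in S(\Sigma)$ let $g_v^+$ and $g_v^-$ be the unit speed geodesic rays in $\Sigma$ with initial velocities $v$ and $-v$. (If the base point of $v$ lies on $\partial\Sigma$ and $\pm v$ points out of $\Sigma$, then the ray $g_v^{\pm}$ consists of the time $0$ only.) Let both rays grow from time $0$ at unit speed. A ray is stopped at the first time at which it reaches $\partial\Sigma$ at a positive time, or cannot be continued in $\Sigma$, or reaches a point already drawn by itself or by the other ray; a stopped ray is kept as it is, and the other ray grows on until it is stopped too. If the two rays reach the same point at the same positive time, this stops $g_v^+$ but not $g_v^-$. Let $t_+,t_-\in[0,\infty]$ be the stopping times of $g_v^+$ and $g_v^-$ (with $\infty$ if a ray is never stopped). The graph of $v$ is $$G_\Sigma(v)=g_v^+([0,t_+])\cup g_v^-([0,t_-])\cup B,$$ where $[0,\infty]$ is read as $[0,\infty)$ and $B$ is the union of those components of $\partial\Sigma$ that contain an end point $g_v^+(t_+)$ or $g_v^-(t_-)$. **Lassos.**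 A positively oriented lasso is a geodesic path $\alpha:[T_1,T_2]\to\Sigma$ such that $\alpha(T_1)\in\partial\Sigma$, $\alpha$ is injective on $(T_1,T_2)$, and $\alpha(T_3)=\alpha(T_2)$ for some $T_1\le T_3<T_2$. The point $\alpha(T_3)=\alpha(T_2)$ is its knot. **Proposition.** Let $\alpha:[T_1,T_2]\to\Sigma$ be a positively oriented lasso with knot $\alpha(T_3)=\alpha(T_2)$, and suppose that $T_1<T_3$, i.e. that the knot is not the base point $\alpha(T_1)$. Then for every $t\in[T_1,T_2]$, $$G_\Sigma(\alpha'(t))\setminus\partial\Sigma=\alpha((T_1,T_2])\quad\Longleftrightarrow\quad T_1\le t\le\frac{T_2+T_3}{2}.$$ -/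

import Mathlib

open scoped Topology UpperHalfPlane

noncomputable section

namespace Hyp

/-- A closed half-plane of the hyperbolic plane: the part of the upper half-plane on one side
(boundary included) of the complete geodesic `re z = 0`. It is the local model of a hyperbolic
surface with geodesic boundary. -/
abbrev HalfPlane : Type := {z : ℍ // 0 ≤ z.re}

/-- A hyperbolic surface with geodesic boundary: a space with charts in `HalfPlane` whose
transition maps are locally restrictions of isometries of the hyperbolic plane. The isometry group
is `GL(2, ℝ)` modulo scalars, acting by Möbius maps (determinant positive) and by Möbius maps
composed with complex conjugation (determinant negative). -/
class HyperbolicSurface (S : Type*) [TopologicalSpace S] [ChartedSpace HalfPlane S] : Prop where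
  transition : ∀ e ∈ atlas HalfPlane S, ∀ e' ∈ atlas HalfPlane S, ∀ p ∈ e.source ∩ e'.source,
    ∃ g : GL (Fin 2) ℝ, ∀ᶠ q in 𝓝 p, (e' q : ℍ) = g • (e q : ℍ)

/-- The unit speed parametrization `s ↦ i * exp s` of the geodesic `re z = 0`. Every unit speed
geodesic of the hyperbolic plane is `s ↦ g • axis s` for an isometry `g`. -/
def axis (s : ℝ) : ℍ := ⟨(Real.exp s : ℂ) * Complex.I, by
  rw [Complex.im_ofReal_mul]; simpa using Real.exp_pos s⟩

section

variable {S : Type*} [TopologicalSpace S] [ChartedSpace HalfPlane S]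

/-- The coordinate, in the upper half-plane, of the point `q` in the preferred chart at `p`. -/
def coord (p q : S) : ℍ := (chartAt HalfPlane p q : ℍ)

variable (S) in
/-- The boundary of the surface: the points whose coordinate lies on the boundary geodesic of
`HalfPlane`. -/
def bdry : Set S := {p | (coord p p).re = 0}

/-- `γ` restricted to `I` is a unit speed geodesic path of the surface: in charts it is locally a
unit speed geodesic of the hyperbolic plane. The values of `γ` outside `I` play no role. -/
def IsGeodesicOn (γ : ℝ → S) (I : Set ℝ) : Prop :=
  ∀ t ∈ I, ∃ g : GL (Fin 2) ℝ, ∀ᶠ s in 𝓝[I] t,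
    γ s ∈ (chartAt HalfPlane (γ t)).source ∧ coord (γ t) (γ s) = g • axis s

variable (S) in
/-- Tangent vectors of the surface; the component `vec` is the expression of the vector in the
preferred chart at the base point. -/
@[ext]
structure TangentVec where
  base : S
  vec : ℂ

/-- The opposite tangent vector. -/
instance : Neg (TangentVec S) := ⟨fun v => ⟨v.base, -v.vec⟩⟩

variable (S) in
/-- The unit tangent bundle, for the hyperbolic metric `|dz| / im z`. -/
def unitTangentBundle : Set (TangentVec S) := {v | ‖v.vec‖ = (coord v.base v.base).im}

/-- The velocity vector at time `t` of a path `γ` with domain `I` (one-sided at an end of `I`). -/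
def velocity (γ : ℝ → S) (I : Set ℝ) (t : ℝ) : TangentVec S :=
  ⟨γ t, derivWithin (fun s => (coord (γ t) (γ s) : ℂ)) I t⟩

/-- `γ` restricted to `[0, T]` is the geodesic path in the surface with initial velocity `v`. For
`T = 0` this is the constant path at the base point of `v`. -/
def IsRay (v : TangentVec S) (γ : ℝ → S) (T : ℝ) : Prop :=
  γ 0 = v.base ∧ IsGeodesicOn γ (Set.Icc 0 T) ∧ (0 < T → velocity γ (Set.Icc 0 T) 0 = v)

/-- The times `t ≥ 0` up to which the geodesic ray with initial velocity `v` exists in the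
surface. For a vector at a boundary point that points out of the surface this is `{0}`. -/
def rayDomain (v : TangentVec S) : Set ℝ := {t | 0 ≤ t ∧ ∃ γ : ℝ → S, IsRay v γ t}

open Classical in
/-- The geodesic ray with initial velocity `v`, at a time `t` in `rayDomain v`. The two rays
determined by `v` are `ray v` (forward) and `ray (-v)` (backward). -/
def ray (v : TangentVec S) (t : ℝ) : S :=
  if h : ∃ γ : ℝ → S, IsRay v γ t then h.choose t else v.base

/-- At time `t` the ray with initial velocity `v` is stopped by the boundary: it runs into the
boundary at a positive time, or it cannot be continued inside the surface. -/
def HitsBdry (v : TangentVec S) (t : ℝ) : Prop :=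
  (0 < t ∧ ray v t ∈ bdry S) ∨ ∀ s ∈ rayDomain v, s ≤ t

/-- At time `t` the ray with initial velocity `v` runs into its own past. -/
def HitsSelf (v : TangentVec S) (t : ℝ) : Prop := ∃ s ∈ Set.Ico 0 t, ray v s = ray v t

/-- The first time at which the forward ray of `v` hits the boundary, itself, or the part of the
backward ray that is already drawn, where the backward ray grows at the same speed and is frozen
at time `τ`. It is `⊤` if this never happens. -/
def stopForward (v : TangentVec S) (τ : EReal) : EReal :=
  sInf ((fun t : ℝ => (t : EReal)) '' {t | t ∈ rayDomain v ∧
    (HitsBdry v t ∨ HitsSelf v t ∨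
      (0 < t ∧ ∃ s ∈ Set.Icc 0 t ∩ rayDomain (-v), (s : EReal) ≤ τ ∧ ray (-v) s = ray v t))})

/-- The first time at which the backward ray of `v` hits the boundary, itself, or the part of the
forward ray that is already drawn, where the forward ray grows at the same speed and is frozen
at time `τ`. When the two rays meet head-on (same point, same time), the forward ray is the one
that is stopped; hence only the points drawn strictly before time `t` are obstacles here. -/
def stopBackward (v : TangentVec S) (τ : EReal) : EReal :=
  sInf ((fun t : ℝ => (t : EReal)) '' {t | t ∈ rayDomain (-v) ∧
    (HitsBdry (-v) t ∨ HitsSelf (-v) t ∨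
      ∃ s ∈ Set.Ico 0 t ∩ rayDomain v, (s : EReal) ≤ τ ∧ ray v s = ray (-v) t)})

open Classical in
/-- The pair of lengths of the forward and of the backward ray in the graph of `v`. Both rays grow
at unit speed; the ray that is stopped first is frozen, and the other one grows on until it is
stopped too. -/
def stopTimes (v : TangentVec S) : EReal × EReal :=
  if stopForward v ⊤ ≤ stopBackward v ⊤ then
    (stopForward v ⊤, stopBackward v (stopForward v ⊤))
  else
    (stopForward v (stopBackward v ⊤), stopBackward v ⊤)

/-- The arc drawn by the ray with initial velocity `v` up to time `τ`. -/
def arc (v : TangentVec S) (τ : EReal) : Set S :=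
  ray v '' {t | t ∈ rayDomain v ∧ (t : EReal) ≤ τ}

/-- The boundary component at which the ray with initial velocity `v` ends at time `τ`; it is empty
if the end point is not in the boundary. -/
def endComponent (v : TangentVec S) (τ : EReal) : Set S :=
  {q | ∃ t ∈ rayDomain v, (t : EReal) = τ ∧ q ∈ connectedComponentIn (bdry S) (ray v t)}

/-- The graph of a unit tangent vector `v` in the surface: the two geodesic arcs grown from `v`
together with the boundary components at which they end. -/
def graph (v : TangentVec S) : Set S :=
  arc v (stopTimes v).1 ∪ arc (-v) (stopTimes v).2 ∪
    (endComponent v (stopTimes v).1 ∪ endComponent (-v) (stopTimes v).2)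

/-- `α : [T₁, T₂] → S` is a positively oriented lasso with base point `α T₁` and with knot
`α T₃ = α T₂`. -/
structure IsPositiveLasso (α : ℝ → S) (T₁ T₂ T₃ : ℝ) : Prop where
  geodesic : IsGeodesicOn α (Set.Icc T₁ T₂)
  base_mem : α T₁ ∈ bdry S
  injOn : Set.InjOn α (Set.Ioo T₁ T₂)
  le : T₁ ≤ T₃
  lt : T₃ < T₂
  knot : α T₃ = α T₂

/-- Geodesic paths have unit speed. -/
theorem velocity_mem_unitTangentBundle {γ : ℝ → S} {a b t : ℝ} (hab : a < b)
    (ht : t ∈ Set.Icc a b) (hγ : IsGeodesicOn γ (Set.Icc a b)) :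
    velocity γ (Set.Icc a b) t ∈ unitTangentBundle S := by
  obtain ⟨g, hg⟩ := hγ t ht
  have ht0 : coord (γ t) (γ t) = g • axis t := (hg.self_of_nhdsWithin ht).2
  have hd : UpperHalfPlane.denom g (axis t) ≠ 0 := UpperHalfPlane.denom_ne_zero g (axis t)
  have hax : HasDerivAt (fun s : ℝ => (axis s : ℂ)) ((Real.exp t : ℂ) * Complex.I) t := by
    simpa [axis] using ((Real.hasDerivAt_exp t).ofReal_comp).mul_const Complex.I
  have hn : HasDerivAt (fun s : ℝ => UpperHalfPlane.num g (axis s))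
      ((g 0 0 : ℂ) * ((Real.exp t : ℂ) * Complex.I)) t := by
    simpa [UpperHalfPlane.num] using (hax.const_mul (g 0 0 : ℂ)).add_const (g 0 1 : ℂ)
  have hde : HasDerivAt (fun s : ℝ => UpperHalfPlane.denom g (axis s))
      ((g 1 0 : ℂ) * ((Real.exp t : ℂ) * Complex.I)) t := by
    simpa [UpperHalfPlane.denom] using (hax.const_mul (g 1 0 : ℂ)).add_const (g 1 1 : ℂ)
  have hq := hn.div hde hd
  have hσ := ((UpperHalfPlane.σ g).toContinuousLinearEquiv.toContinuousLinearMap.hasFDerivAt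
    (x := UpperHalfPlane.num g (axis t) / UpperHalfPlane.denom g (axis t))).comp_hasDerivAt t hq
  have hw : HasDerivWithinAt (fun s => (coord (γ t) (γ s) : ℂ)) _ (Set.Icc a b) t :=
    hσ.hasDerivWithinAt.congr_of_eventuallyEq
      (hg.mono fun s hs => by simp only [hs.2]; rfl) (by simp only [ht0]; rfl)
  have hv := hw.derivWithin (uniqueDiffOn_Icc hab t ht)
  change ‖derivWithin (fun s => (coord (γ t) (γ s) : ℂ)) (Set.Icc a b) t‖ = (coord (γ t) (γ t)).im
  rw [hv, ht0, UpperHalfPlane.im_smul_eq_div_normSq]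
  have hdet : (g.det.val : ℂ) = g 0 0 * g 1 1 - g 0 1 * g 1 0 := by
    simp [Matrix.det_fin_two]
  have hnum : (g 0 0 : ℂ) * ((Real.exp t : ℂ) * Complex.I) * UpperHalfPlane.denom g (axis t) -
      UpperHalfPlane.num g (axis t) * ((g 1 0 : ℂ) * ((Real.exp t : ℂ) * Complex.I)) =
      (g.det.val : ℂ) * ((Real.exp t : ℂ) * Complex.I) := by
    rw [hdet, UpperHalfPlane.num, UpperHalfPlane.denom]; ring
  change ‖UpperHalfPlane.σ g _‖ = _
  rw [UpperHalfPlane.norm_σ, hnum, Complex.normSq_eq_norm_sq]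
  have him : (axis t).im = Real.exp t := by
    change ((Real.exp t : ℂ) * Complex.I).im = _
    rw [Complex.im_ofReal_mul]; simp
  have he : ‖(Real.exp t : ℂ)‖ = Real.exp t := by
    rw [Complex.norm_real, Real.norm_of_nonneg (Real.exp_pos t).le]
  rw [him, norm_div, norm_mul, norm_mul, he, norm_pow, Complex.norm_real, Real.norm_eq_abs,
    Complex.norm_I, mul_one]

end

end Hyp

end

noncomputable section

namespace Hyp

/-! Two facts make a lasso with `T₁ < T₃` rigid. It meets the boundary only at its base point: a
geodesic touching the boundary at an inner time is tangent to it and hence stays in it, and a lasso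
inside the boundary would have overlapping strands at the knot. And its only double point is the
knot, visited at the times `T₃` and `T₂`; the strands cross there, since two geodesics with a second
common point coincide up to shift or reversal, against injectivity on `(T₁, T₂)`. So the knot is an
inner point of the surface, and the lasso prolongs to a geodesic `β` on `[T₁, T]`, `T > T₂`, with no
new double point and no new boundary point (`IsPositiveLasso.exists_extension`).

By uniqueness of geodesics the rays of `α'(t)` are `β (t + s)`, at least up to `s = T - t`, and `β
(t - s)`, which exists exactly up to `s = t - T₁`. The forward ray reaches the knot at time `T₂ -
t`. The knot is already drawn if `t ≤ T₃`, by the forward ray itself; if `T₃ < t`, the backward ray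
gets there at time `t - T₃`, which is not later exactly when `t ≤ (T₂ + T₃) / 2`. A tie stops the
forward ray only.

Hence up to the midpoint the forward ray ends at the knot, the backward ray at the base point, and
together they draw the lasso. Beyond the midpoint the forward ray runs through the knot and draws
the new point `β T`. `LassoRays` collects what this comparison of times needs; `forward_hit` and
`backward_hit` carry it out. -/

/-! ### Geodesics of the hyperbolic plane in matrix coordinates -/

theorem axis_re (s : ℝ) : (axis s).re = 0 := by
  change ((Real.exp s : ℂ) * Complex.I).re = 0
  simp

theorem axis_im (s : ℝ) : (axis s).im = Real.exp s := by
  change ((Real.exp s : ℂ) * Complex.I).im = _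
  simp [Complex.exp_ofReal_re]

theorem axis_injective : Function.Injective axis := fun s t h => by
  have := congrArg UpperHalfPlane.im h
  rwa [axis_im, axis_im, Real.exp_eq_exp] at this

theorem coe_axis (s : ℝ) : (axis s : ℂ) = (Real.exp s : ℂ) * Complex.I := rfl

theorem det_ne_zero_entries (g : GL (Fin 2) ℝ) : g 0 0 * g 1 1 - g 0 1 * g 1 0 ≠ 0 := by
  have := g.det.ne_zero
  rwa [Matrix.GeneralLinearGroup.val_det_apply, Matrix.det_fin_two] at this

theorem smul_axis_den_pos (g : GL (Fin 2) ℝ) (s : ℝ) :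
    0 < (g 1 0) ^ 2 * Real.exp s ^ 2 + (g 1 1) ^ 2 := by
  have hD := det_ne_zero_entries g
  have hx := Real.exp_pos s
  by_cases hc : g 1 0 = 0
  · have hd : g 1 1 ≠ 0 := by rintro hd; simp [hc, hd] at hD
    positivity
  · positivity

theorem normSq_denom_axis (g : GL (Fin 2) ℝ) (s : ℝ) :
    Complex.normSq (UpperHalfPlane.denom g (axis s)) =
      (g 1 0) ^ 2 * Real.exp s ^ 2 + (g 1 1) ^ 2 := by
  rw [UpperHalfPlane.denom, coe_axis, Complex.normSq_apply]
  simp [-Complex.ofReal_exp]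
  ring

theorem re_smul_axis (g : GL (Fin 2) ℝ) (s : ℝ) :
    (g • axis s).re = (g 0 0 * g 1 0 * Real.exp s ^ 2 + g 0 1 * g 1 1) /
      ((g 1 0) ^ 2 * Real.exp s ^ 2 + (g 1 1) ^ 2) := by
  rw [UpperHalfPlane.re_smul, Complex.div_re, normSq_denom_axis, ← add_div]
  congr 1
  rw [UpperHalfPlane.denom, UpperHalfPlane.num, coe_axis]
  simp [-Complex.ofReal_exp]
  ring

theorem im_smul_axis (g : GL (Fin 2) ℝ) (s : ℝ) :
    (g • axis s).im = |g 0 0 * g 1 1 - g 0 1 * g 1 0| * Real.exp s /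
      ((g 1 0) ^ 2 * Real.exp s ^ 2 + (g 1 1) ^ 2) := by
  rw [UpperHalfPlane.im_smul_eq_div_normSq, normSq_denom_axis, axis_im,
    Matrix.GeneralLinearGroup.val_det_apply, Matrix.det_fin_two]

theorem continuous_axis : Continuous axis := by
  rw [UpperHalfPlane.isEmbedding_coe.continuous_iff]
  change Continuous fun s : ℝ => (Real.exp s : ℂ) * Complex.I
  fun_prop

theorem continuous_smul_axis (g : GL (Fin 2) ℝ) : Continuous fun s => g • axis s :=
  continuous_axis.const_smul g

/-- A geodesic that meets the line `re z = 0` twice is a parametrization of this line. -/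
theorem smul_axis_eq_axis_of_re_eq_zero {g : GL (Fin 2) ℝ} {s t : ℝ} (hst : s ≠ t)
    (hs : (g • axis s).re = 0) (ht : (g • axis t).re = 0) :
    ∃ c, (∀ u, g • axis u = axis (c + u)) ∨ ∀ u, g • axis u = axis (c - u) := by
  have hD := det_ne_zero_entries g
  rw [re_smul_axis, div_eq_zero_iff, or_iff_left (smul_axis_den_pos g _).ne'] at hs ht
  have hx : Real.exp s ^ 2 - Real.exp t ^ 2 ≠ 0 := by
    rw [sub_ne_zero]
    intro h
    exact hst (Real.exp_injective
      ((pow_left_inj₀ (Real.exp_pos s).le (Real.exp_pos t).le two_ne_zero).1 h))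
  -- The numerator of the real part is affine in `exp u ^ 2`. It vanishes at two values, so both
  -- coefficients vanish, and `g` is antidiagonal (time reversed) or diagonal (time shifted).
  have hac : g 0 0 * g 1 0 = 0 := by
    refine (mul_eq_zero.1 ?_).resolve_right hx
    linear_combination hs - ht
  have hbd : g 0 1 * g 1 1 = 0 := by linear_combination hs - Real.exp s ^ 2 * hac
  have hre : ∀ u, (g • axis u).re = 0 := fun u => by rw [re_smul_axis, hac, hbd]; simp
  rcases mul_eq_zero.1 hac with ha | hc
  · have hb : g 0 1 ≠ 0 := by rintro hb; simp [ha, hb] at hD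
    have hd : g 1 1 = 0 := (mul_eq_zero.1 hbd).resolve_left hb
    have hc : g 1 0 ≠ 0 := by rintro hc; simp [hc, hd] at hD
    have hp : 0 < |g 0 1 / g 1 0| := abs_pos.2 (div_ne_zero hb hc)
    refine ⟨Real.log |g 0 1 / g 1 0|, Or.inr fun u => UpperHalfPlane.ext_iff.2
      (Complex.ext ?_ ?_)⟩
    · exact (hre u).trans (axis_re _).symm
    · refine (im_smul_axis g u).trans (Eq.trans ?_ (axis_im _).symm)
      have := Real.exp_pos u
      rw [Real.exp_sub, Real.exp_log hp, ha, hd, abs_div, zero_mul, zero_sub, abs_neg, abs_mul,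
        ← sq_abs (g 1 0)]
      have := abs_pos.2 hc
      field_simp
      simp
  · have hd : g 1 1 ≠ 0 := by rintro hd; simp [hc, hd] at hD
    have hb : g 0 1 = 0 := (mul_eq_zero.1 hbd).resolve_right hd
    have ha : g 0 0 ≠ 0 := by rintro ha; simp [ha, hb] at hD
    have hp : 0 < |g 0 0 / g 1 1| := abs_pos.2 (div_ne_zero ha hd)
    refine ⟨Real.log |g 0 0 / g 1 1|, Or.inl fun u => UpperHalfPlane.ext_iff.2
      (Complex.ext ?_ ?_)⟩
    · exact (hre u).trans (axis_re _).symm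
    · refine (im_smul_axis g u).trans (Eq.trans ?_ (axis_im _).symm)
      have := Real.exp_pos u
      rw [Real.exp_add, Real.exp_log hp, hb, hc, abs_div, zero_mul, sub_zero, abs_mul,
        ← sq_abs (g 1 1)]
      have := abs_pos.2 hd
      field_simp
      simp

theorem smul_axis_injective (g : GL (Fin 2) ℝ) : Function.Injective fun s => g • axis s :=
  (MulAction.injective g).comp axis_injective

/-- Two geodesics with two common points agree up to a translation or a reflection of time. -/
theorem smul_axis_eq_of_two_points {g h : GL (Fin 2) ℝ} {s t s' t' : ℝ} (hst : s ≠ t)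
    (hs : g • axis s = h • axis s') (ht : g • axis t = h • axis t') :
    (∀ u, g • axis (s + u) = h • axis (s' + u)) ∨ ∀ u, g • axis (s + u) = h • axis (s' - u) := by
  have hs' : (h⁻¹ * g) • axis s = axis s' := by rw [mul_smul, hs, inv_smul_smul]
  have ht' : (h⁻¹ * g) • axis t = axis t' := by rw [mul_smul, ht, inv_smul_smul]
  obtain ⟨c, hc | hc⟩ := smul_axis_eq_axis_of_re_eq_zero hst
    (by rw [hs', axis_re]) (by rw [ht', axis_re])
  · left
    intro u
    have h1 := axis_injective ((hc s).symm.trans hs')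
    rw [← inv_smul_eq_iff, ← mul_smul, hc, ← h1, add_assoc]
  · right
    intro u
    have h1 := axis_injective ((hc s).symm.trans hs')
    rw [← inv_smul_eq_iff, ← mul_smul, hc, ← h1, sub_sub]

theorem smul_axis_eq_of_eq_of_eq {g h : GL (Fin 2) ℝ} {s t : ℝ} (hst : s ≠ t)
    (hs : g • axis s = h • axis s) (ht : g • axis t = h • axis t) (u : ℝ) :
    g • axis u = h • axis u := by
  rcases smul_axis_eq_of_two_points hst hs ht with H | H
  · simpa using H (u - s)
  · have h1 := H (t - s)
    rw [add_sub_cancel, ht] at h1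
    have := smul_axis_injective h h1
    exact absurd (by linarith) hst

theorem exists_smul_axis_add (g : GL (Fin 2) ℝ) (c : ℝ) :
    ∃ h : GL (Fin 2) ℝ, ∀ s, g • axis (c + s) = h • axis s := by
  -- The dilation by `exp c` shifts the axis by `c`.
  refine ⟨g * Matrix.GeneralLinearGroup.mkOfDetNeZero !![Real.exp c, 0; 0, 1]
    (by simp), fun s => ?_⟩
  rw [mul_smul]
  congr 1
  refine UpperHalfPlane.ext_iff.2 (Complex.ext ?_ ?_)
  · refine (axis_re _).trans (Eq.trans ?_ (re_smul_axis _ s).symm)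
    simp [Matrix.GeneralLinearGroup.mkOfDetNeZero]
  · refine (axis_im _).trans (Eq.trans ?_ (im_smul_axis _ s).symm)
    simp [Matrix.GeneralLinearGroup.mkOfDetNeZero, Real.exp_add]

theorem exists_smul_axis_sub (g : GL (Fin 2) ℝ) (c : ℝ) :
    ∃ h : GL (Fin 2) ℝ, ∀ s, g • axis (c - s) = h • axis s := by
  -- The determinant is negative, so this acts as the inversion of `z` to `exp c` divided by the
  -- conjugate of `z`, which reverses the axis.
  refine ⟨g * Matrix.GeneralLinearGroup.mkOfDetNeZero !![0, Real.exp c; 1, 0]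
    (by simp), fun s => ?_⟩
  rw [mul_smul]
  congr 1
  refine UpperHalfPlane.ext_iff.2 (Complex.ext ?_ ?_)
  · refine (axis_re _).trans (Eq.trans ?_ (re_smul_axis _ s).symm)
    simp [Matrix.GeneralLinearGroup.mkOfDetNeZero]
  · refine (axis_im _).trans (Eq.trans ?_ (im_smul_axis _ s).symm)
    have := Real.exp_pos s
    simp [Matrix.GeneralLinearGroup.mkOfDetNeZero, Real.exp_sub]
    field_simp

/-- A geodesic that touches `re z = 0` from the side `0 ≤ re z` lies in this line. -/
theorem re_smul_axis_eq_zero_of_nonneg {g : GL (Fin 2) ℝ} {s : ℝ} (hs : (g • axis s).re = 0)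
    (h : ∀ᶠ u in 𝓝 s, 0 ≤ (g • axis u).re) (u : ℝ) : (g • axis u).re = 0 := by
  rw [re_smul_axis, div_eq_zero_iff, or_iff_left (smul_axis_den_pos g _).ne'] at hs
  have key : ∀ u, (g • axis u).re = g 0 0 * g 1 0 * (Real.exp u ^ 2 - Real.exp s ^ 2) /
      ((g 1 0) ^ 2 * Real.exp u ^ 2 + (g 1 1) ^ 2) := fun u => by
    rw [re_smul_axis]
    congr 1
    linear_combination hs
  have hnn : ∀ᶠ u in 𝓝 s, 0 ≤ g 0 0 * g 1 0 * (Real.exp u ^ 2 - Real.exp s ^ 2) := by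
    filter_upwards [h] with u hu
    rw [key] at hu
    by_contra! hlt
    exact absurd hu (not_le.2 (div_neg_of_neg_of_pos hlt (smul_axis_den_pos g u)))
  have hsq : ∀ {a b : ℝ}, a < b → Real.exp a ^ 2 < Real.exp b ^ 2 := fun hab =>
    pow_lt_pow_left₀ (Real.exp_lt_exp.2 hab) (Real.exp_pos _).le two_ne_zero
  -- The factor `exp u ^ 2 - exp s ^ 2` changes sign at `s`, so its coefficient must vanish.
  have h0 : g 0 0 * g 1 0 = 0 := by
    obtain ⟨a, ha, has⟩ := ((hnn.filter_mono nhdsWithin_le_nhds).and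
      (self_mem_nhdsWithin (a := s) (s := Set.Iio s))).exists
    obtain ⟨b, hb, hbs⟩ := ((hnn.filter_mono nhdsWithin_le_nhds).and
      (self_mem_nhdsWithin (a := s) (s := Set.Ioi s))).exists
    have h1 := hsq has
    have h2 := hsq hbs
    refine le_antisymm ?_ ?_
    · exact nonpos_of_mul_nonneg_left ha (by linarith)
    · exact nonneg_of_mul_nonneg_left hb (by linarith)
  rw [key, h0]
  simp

/-! ### Velocities, and geodesics with given initial data -/

/-- The velocity at time `t` of the geodesic `s ↦ g • axis s`. -/
def axisVelocity (g : GL (Fin 2) ℝ) (t : ℝ) : ℂ :=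
  deriv (fun s => ((g • axis s : ℍ) : ℂ)) t

theorem hasDerivAt_re_smul_axis (g : GL (Fin 2) ℝ) (t : ℝ) :
    HasDerivAt (fun s => (g • axis s).re)
      (2 * Real.exp t ^ 2 * (g 1 0 * g 1 1) * (g 0 0 * g 1 1 - g 0 1 * g 1 0) /
        ((g 1 0) ^ 2 * Real.exp t ^ 2 + (g 1 1) ^ 2) ^ 2) t := by
  simp_rw [re_smul_axis]
  have hx := (Real.hasDerivAt_exp t).pow 2
  have h := ((hx.const_mul (g 0 0 * g 1 0)).add_const (g 0 1 * g 1 1)).div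
    ((hx.const_mul ((g 1 0) ^ 2)).add_const ((g 1 1) ^ 2)) (smul_axis_den_pos g t).ne'
  refine HasDerivAt.congr_deriv h ?_
  simp only [Pi.pow_apply]
  congr 1
  push_cast
  ring

theorem hasDerivAt_im_smul_axis (g : GL (Fin 2) ℝ) (t : ℝ) :
    HasDerivAt (fun s => (g • axis s).im)
      (|g 0 0 * g 1 1 - g 0 1 * g 1 0| * Real.exp t *
        ((g 1 1) ^ 2 - (g 1 0) ^ 2 * Real.exp t ^ 2) /
        ((g 1 0) ^ 2 * Real.exp t ^ 2 + (g 1 1) ^ 2) ^ 2) t := by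
  simp_rw [im_smul_axis]
  have hx := (Real.hasDerivAt_exp t).pow 2
  have h := ((Real.hasDerivAt_exp t).const_mul |g 0 0 * g 1 1 - g 0 1 * g 1 0|).div
    ((hx.const_mul ((g 1 0) ^ 2)).add_const ((g 1 1) ^ 2)) (smul_axis_den_pos g t).ne'
  refine HasDerivAt.congr_deriv h ?_
  simp only [Pi.pow_apply]
  congr 1
  push_cast
  ring

theorem hasDerivAt_smul_axis_aux (g : GL (Fin 2) ℝ) (t : ℝ) :
    HasDerivAt (fun s => ((g • axis s : ℍ) : ℂ))
      (((2 * Real.exp t ^ 2 * (g 1 0 * g 1 1) * (g 0 0 * g 1 1 - g 0 1 * g 1 0) /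
        ((g 1 0) ^ 2 * Real.exp t ^ 2 + (g 1 1) ^ 2) ^ 2 : ℝ) : ℂ) +
      ((|g 0 0 * g 1 1 - g 0 1 * g 1 0| * Real.exp t *
        ((g 1 1) ^ 2 - (g 1 0) ^ 2 * Real.exp t ^ 2) /
        ((g 1 0) ^ 2 * Real.exp t ^ 2 + (g 1 1) ^ 2) ^ 2 : ℝ) : ℂ) * Complex.I) t := by
  have h := (hasDerivAt_re_smul_axis g t).ofReal_comp.add
    ((hasDerivAt_im_smul_axis g t).ofReal_comp.mul_const Complex.I)
  refine h.congr_of_eventuallyEq (Filter.Eventually.of_forall fun s => ?_)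
  exact (Complex.re_add_im _).symm

theorem hasDerivAt_smul_axis (g : GL (Fin 2) ℝ) (t : ℝ) :
    HasDerivAt (fun s => ((g • axis s : ℍ) : ℂ)) (axisVelocity g t) t :=
  (hasDerivAt_smul_axis_aux g t).differentiableAt.hasDerivAt

theorem axisVelocity_re (g : GL (Fin 2) ℝ) (t : ℝ) : (axisVelocity g t).re =
    2 * Real.exp t ^ 2 * (g 1 0 * g 1 1) * (g 0 0 * g 1 1 - g 0 1 * g 1 0) /
        ((g 1 0) ^ 2 * Real.exp t ^ 2 + (g 1 1) ^ 2) ^ 2 := by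
  rw [axisVelocity, (hasDerivAt_smul_axis_aux g t).deriv]
  simp only [Complex.add_re, Complex.re_ofReal_mul, Complex.ofReal_re, Complex.I_re, mul_zero,
    add_zero]

theorem axisVelocity_im (g : GL (Fin 2) ℝ) (t : ℝ) : (axisVelocity g t).im =
    |g 0 0 * g 1 1 - g 0 1 * g 1 0| * Real.exp t *
        ((g 1 1) ^ 2 - (g 1 0) ^ 2 * Real.exp t ^ 2) /
        ((g 1 0) ^ 2 * Real.exp t ^ 2 + (g 1 1) ^ 2) ^ 2 := by
  rw [axisVelocity, (hasDerivAt_smul_axis_aux g t).deriv]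
  simp only [Complex.add_im, Complex.im_ofReal_mul, Complex.ofReal_im, Complex.I_im, mul_one,
    zero_add]

/-- Normal form of a geodesic: its parameters are determined by its position and velocity. -/
theorem exists_normal_form (g : GL (Fin 2) ℝ) (t : ℝ) :
    ∃ A B P Q : ℝ, (∀ s, 0 < A * Real.exp s ^ 2 + B) ∧
      (∀ s, (g • axis s).im = Real.exp s / (A * Real.exp s ^ 2 + B)) ∧
      (∀ s, (g • axis s).re = (P * Real.exp s ^ 2 + Q) / (A * Real.exp s ^ 2 + B)) ∧
      (axisVelocity g t).im =
        Real.exp t * (B - A * Real.exp t ^ 2) / (A * Real.exp t ^ 2 + B) ^ 2 ∧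
      (axisVelocity g t).re =
        2 * Real.exp t ^ 2 * (P * B - Q * A) / (A * Real.exp t ^ 2 + B) ^ 2 := by
  have hD := abs_pos.2 (det_ne_zero_entries g)
  rw [axisVelocity_im, axisVelocity_re]
  simp_rw [im_smul_axis, re_smul_axis]
  have hpos := smul_axis_den_pos g
  set D := |g 0 0 * g 1 1 - g 0 1 * g 1 0|
  have hden : ∀ s, (g 1 0) ^ 2 / D * Real.exp s ^ 2 + (g 1 1) ^ 2 / D =
      ((g 1 0) ^ 2 * Real.exp s ^ 2 + (g 1 1) ^ 2) / D := fun s => by ring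
  -- Dividing by the absolute value of the determinant removes the scaling ambiguity of `g`.
  refine ⟨(g 1 0) ^ 2 / D, (g 1 1) ^ 2 / D, g 0 0 * g 1 0 / D, g 0 1 * g 1 1 / D,
    fun s => ?_, fun s => ?_, fun s => ?_, ?_, ?_⟩
  · rw [hden]
    exact div_pos (hpos s) hD
  · rw [hden]
    have := (hpos s).ne'
    field_simp
  · rw [hden]
    have := (hpos s).ne'
    field_simp
  · rw [hden]
    have := (hpos t).ne'
    field_simp
  · rw [hden]
    have := (hpos t).ne'
    field_simp

/-- A geodesic is determined by its position and its velocity at one time. -/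
theorem smul_axis_eq_of_velocity_eq {g h : GL (Fin 2) ℝ} {t : ℝ}
    (hp : g • axis t = h • axis t) (hv : axisVelocity g t = axisVelocity h t) (u : ℝ) :
    g • axis u = h • axis u := by
  obtain ⟨A, B, P, Q, hN, him, hre, hvim, hvre⟩ := exists_normal_form g t
  obtain ⟨A', B', P', Q', hN', him', hre', hvim', hvre'⟩ := exists_normal_form h t
  have hx := Real.exp_pos t
  have e1 := him t
  rw [hp, him', div_eq_div_iff (hN' t).ne' (hN t).ne'] at e1
  have hNN : A * Real.exp t ^ 2 + B = A' * Real.exp t ^ 2 + B' := mul_left_cancel₀ hx.ne' e1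
  have e2 := hvim
  rw [hv, hvim', hNN, div_left_inj' (by have := hN' t; positivity)] at e2
  have e2' := mul_left_cancel₀ hx.ne' e2
  have hx2 : Real.exp t ^ 2 ≠ 0 := by positivity
  have hA : A = A' := mul_right_cancel₀ hx2 (by linarith)
  have hB : B = B' := by linarith [hA ▸ hNN]
  subst hA hB
  have e3 := hre t
  rw [hp, hre', div_left_inj' (hN t).ne'] at e3
  have e4 := hvre
  rw [hv, hvre', div_left_inj' (by have := hN t; positivity)] at e4
  have e4' : P' * B - Q' * A = P * B - Q * A :=
    mul_left_cancel₀ (by positivity : 2 * Real.exp t ^ 2 ≠ 0) (by linarith)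
  -- `e3` and `e4'` are linear equations for `(P, Q)` with determinant `-(A * exp t ^ 2 + B)`, which
  -- is nonzero.
  have hP : P = P' := by
    refine mul_right_cancel₀ (hN t).ne' ?_
    linear_combination (-A) * e3 - e4'
  subst hP
  have hQ : Q = Q' := by linarith
  subst hQ
  refine UpperHalfPlane.ext_iff.2 (Complex.ext ?_ ?_)
  · exact (hre u).trans (hre' u).symm
  · exact (him u).trans (him' u).symm

/-! ### The half-plane model and boundary points in charts -/

/-- The retraction of the hyperbolic plane onto the half-plane that replaces `re z` by
`max 0 (re z)`. -/
def toHalf (z : ℍ) : HalfPlane :=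
  ⟨⟨⟨max 0 z.re, z.im⟩, z.im_pos⟩, le_max_left 0 z.re⟩

theorem continuous_toHalf : Continuous toHalf := by
  refine Continuous.subtype_mk ?_ _
  rw [UpperHalfPlane.isEmbedding_coe.continuous_iff]
  have : Continuous fun z : ℍ => ((max 0 z.re : ℝ) : ℂ) + (z.im : ℂ) * Complex.I := by
    have h1 := UpperHalfPlane.continuous_re
    have h2 := UpperHalfPlane.continuous_im
    fun_prop
  convert this using 1
  ext z
  exact Complex.mk_eq_add_mul_I _ _

theorem coe_toHalf {z : ℍ} (hz : 0 ≤ z.re) : (toHalf z : ℍ) = z :=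
  UpperHalfPlane.ext_iff.2 (Complex.ext (max_eq_right hz) rfl)

theorem toHalf_coe (z : HalfPlane) : toHalf z = z := Subtype.ext (coe_toHalf z.2)

section

variable {S : Type*} [TopologicalSpace S] [ChartedSpace HalfPlane S]

theorem coord_re_nonneg (p q : S) : 0 ≤ (coord p q).re := (chartAt HalfPlane p q).2

theorem eq_of_coord_eq {p q q' : S} (hq : q ∈ (chartAt HalfPlane p).source)
    (hq' : q' ∈ (chartAt HalfPlane p).source) (h : coord p q = coord p q') : q = q' :=
  (chartAt HalfPlane p).injOn hq hq' (Subtype.ext h)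

/-- Transition maps send boundary points to boundary points. -/
theorem re_eq_zero_of_re_eq_zero [HyperbolicSurface S] {e e' : OpenPartialHomeomorph S HalfPlane}
    (he : e ∈ atlas HalfPlane S) (he' : e' ∈ atlas HalfPlane S) {p : S} (hp : p ∈ e.source)
    (hp' : p ∈ e'.source) (h : (e p : ℍ).re = 0) : (e' p : ℍ).re = 0 := by
  by_contra hne
  have hpos : 0 < (e' p : ℍ).re := lt_of_le_of_ne (e' p).2 (Ne.symm hne)
  obtain ⟨g, hg⟩ := HyperbolicSurface.transition e he e' he' p ⟨hp, hp'⟩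
  have ht : Filter.Tendsto toHalf (𝓝 (e' p : ℍ)) (𝓝 (e' p)) := by
    simpa [toHalf_coe] using continuous_toHalf.tendsto (e' p : ℍ)
  have hs : Filter.Tendsto (fun w => e'.symm (toHalf w)) (𝓝 (e' p : ℍ)) (𝓝 p) := by
    have := (e'.tendsto_symm hp').comp ht
    exact this
  -- If `e' p` is inner, a full neighbourhood of it in `ℍ` comes from the surface, so `g⁻¹` maps it
  -- into `0 ≤ re z`. Moving `e p` to the left contradicts this.
  have h1 : ∀ᶠ w in 𝓝 (e' p : ℍ), 0 ≤ (g⁻¹ • w : ℍ).re := by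
    filter_upwards [ht.eventually (e'.open_target.mem_nhds (e'.map_source hp')),
      hs.eventually hg, UpperHalfPlane.continuous_re.continuousAt.eventually
        (lt_mem_nhds hpos)] with w hw1 hw2 hw3
    rw [e'.right_inv hw1, coe_toHalf hw3.le, ← inv_smul_eq_iff] at hw2
    rw [hw2]
    exact (e _).2
  have hep : (e' p : ℍ) = g • (e p : ℍ) := hg.self_of_nhds
  have h2 : ∀ᶠ z in 𝓝 (e p : ℍ), 0 ≤ (z : ℍ).re := by
    have hc : Filter.Tendsto (fun z : ℍ => g • z) (𝓝 (e p : ℍ)) (𝓝 (e' p : ℍ)) := by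
      rw [hep]
      exact (continuous_const_smul g).tendsto _
    filter_upwards [hc.eventually h1] with z hz
    rwa [inv_smul_smul] at hz
  have hc : Continuous fun r : ℝ => r +ᵥ (e p : ℍ) := by
    rw [UpperHalfPlane.isEmbedding_coe.continuous_iff]
    change Continuous fun r : ℝ => (r : ℂ) + ((e p : ℍ) : ℂ)
    fun_prop
  have h3 : ∀ᶠ r in 𝓝 (0 : ℝ), 0 ≤ r := by
    have h4 := hc.tendsto 0
    rw [zero_vadd] at h4
    filter_upwards [h4.eventually h2] with r hr
    rwa [UpperHalfPlane.vadd_re, h, add_zero] at hr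
  obtain ⟨r, hr, hr'⟩ := ((h3.filter_mono nhdsWithin_le_nhds).and
    (self_mem_nhdsWithin (a := (0 : ℝ)) (s := Set.Iio 0))).exists
  exact absurd hr (not_le.2 hr')

theorem mem_bdry_iff_coord [HyperbolicSurface S] {p q : S}
    (hq : q ∈ (chartAt HalfPlane p).source) : q ∈ bdry S ↔ (coord p q).re = 0 :=
  ⟨re_eq_zero_of_re_eq_zero (chart_mem_atlas _ q) (chart_mem_atlas _ p)
    (mem_chart_source _ q) hq,
    re_eq_zero_of_re_eq_zero (chart_mem_atlas _ p) (chart_mem_atlas _ q) hq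
    (mem_chart_source _ q)⟩

/-! ### Germs of geodesic paths -/

/-- In the preferred chart at `γ t`, the path `γ` is given near `t` by the geodesic
`s ↦ g • axis s`. -/
def HasGerm (γ : ℝ → S) (I : Set ℝ) (t : ℝ) (g : GL (Fin 2) ℝ) : Prop :=
  ∀ᶠ s in 𝓝[I] t, γ s ∈ (chartAt HalfPlane (γ t)).source ∧ coord (γ t) (γ s) = g • axis s

theorem IsGeodesicOn.exists_hasGerm {γ : ℝ → S} {I : Set ℝ} (hγ : IsGeodesicOn γ I) {t : ℝ}
    (ht : t ∈ I) : ∃ g, HasGerm γ I t g := hγ t ht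

theorem HasGerm.coord_self {γ : ℝ → S} {I : Set ℝ} {t : ℝ} {g : GL (Fin 2) ℝ}
    (h : HasGerm γ I t g) (ht : t ∈ I) : coord (γ t) (γ t) = g • axis t :=
  (h.self_of_nhdsWithin ht).2

theorem HasGerm.mono {γ : ℝ → S} {I J : Set ℝ} {t : ℝ} {g : GL (Fin 2) ℝ}
    (h : HasGerm γ I t g) (hJ : J ⊆ I) : HasGerm γ J t g :=
  Filter.Eventually.filter_mono (nhdsWithin_mono t hJ) h

theorem IsGeodesicOn.mono {γ : ℝ → S} {I J : Set ℝ} (h : IsGeodesicOn γ I) (hJ : J ⊆ I) :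
    IsGeodesicOn γ J := fun _ ht =>
  (h.exists_hasGerm (hJ ht)).imp fun _ hg => hg.mono hJ

theorem IsGeodesicOn.congr {γ β : ℝ → S} {I : Set ℝ} (h : IsGeodesicOn γ I)
    (heq : Set.EqOn β γ I) : IsGeodesicOn β I := fun t ht => by
  obtain ⟨g, hg⟩ := h t ht
  refine ⟨g, ?_⟩
  filter_upwards [hg, self_mem_nhdsWithin] with s hs hsI
  rwa [heq ht, heq hsI]

theorem continuousWithinAt_of_coord {γ : ℝ → S} {I : Set ℝ} {t : ℝ} {g : GL (Fin 2) ℝ} {p : S}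
    (ht : t ∈ I) (h : ∀ᶠ s in 𝓝[I] t, γ s ∈ (chartAt HalfPlane p).source ∧
      coord p (γ s) = g • axis s) : ContinuousWithinAt γ I t := by
  have h0 := h.self_of_nhdsWithin ht
  rw [(chartAt HalfPlane p).continuousWithinAt_iff_continuousWithinAt_comp_left h0.1
    (h.mono fun s hs => hs.1)]
  refine (⟨rfl⟩ : Topology.IsInducing ((↑) : HalfPlane → ℍ)).continuousWithinAt_iff.2 ?_
  exact (continuous_smul_axis g).continuousWithinAt.congr_of_eventuallyEq
    (h.mono fun s hs => hs.2) h0.2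

theorem HasGerm.continuousWithinAt {γ : ℝ → S} {I : Set ℝ} {t : ℝ} {g : GL (Fin 2) ℝ}
    (h : HasGerm γ I t g) (ht : t ∈ I) : ContinuousWithinAt γ I t :=
  continuousWithinAt_of_coord ht h

theorem IsGeodesicOn.continuousOn {γ : ℝ → S} {I : Set ℝ} (h : IsGeodesicOn γ I) :
    ContinuousOn γ I := fun t ht => by
  obtain ⟨g, hg⟩ := h.exists_hasGerm ht
  exact hg.continuousWithinAt ht

/-- To be a geodesic near a time can be checked in any preferred chart. -/
theorem exists_hasGerm_of_coord [HyperbolicSurface S] {γ : ℝ → S} {I : Set ℝ} {t : ℝ}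
    {g : GL (Fin 2) ℝ} {p : S} (ht : t ∈ I)
    (h : ∀ᶠ s in 𝓝[I] t, γ s ∈ (chartAt HalfPlane p).source ∧ coord p (γ s) = g • axis s) :
    ∃ k, HasGerm γ I t k := by
  have hc := continuousWithinAt_of_coord ht h
  obtain ⟨k, hk⟩ := HyperbolicSurface.transition _ (chart_mem_atlas HalfPlane p) _
    (chart_mem_atlas HalfPlane (γ t)) (γ t)
    ⟨(h.self_of_nhdsWithin ht).1, mem_chart_source _ _⟩
  refine ⟨k * g, ?_⟩
  filter_upwards [h, hc.eventually hk,
    hc.eventually (chart_source_mem_nhds HalfPlane (γ t))] with s hs hs1 hs2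
  refine ⟨hs2, ?_⟩
  change coord (γ t) (γ s) = k • coord p (γ s) at hs1
  rw [hs1, hs.2, mul_smul]

theorem HasGerm.mem_bdry_iff [HyperbolicSurface S] {γ : ℝ → S} {I : Set ℝ} {t : ℝ}
    {g : GL (Fin 2) ℝ} (h : HasGerm γ I t g) :
    ∀ᶠ s in 𝓝[I] t, (γ s ∈ bdry S ↔ (g • axis s).re = 0) := by
  filter_upwards [h] with s hs
  rw [mem_bdry_iff_coord hs.1, hs.2]

theorem HasGerm.re_nonneg {γ : ℝ → S} {I : Set ℝ} {t : ℝ}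
    {g : GL (Fin 2) ℝ} (h : HasGerm γ I t g) : ∀ᶠ s in 𝓝[I] t, 0 ≤ (g • axis s).re := by
  filter_upwards [h] with s hs
  rw [← hs.2]
  exact coord_re_nonneg _ _

theorem HasGerm.hasDerivWithinAt {γ : ℝ → S} {I : Set ℝ} {t : ℝ} {g : GL (Fin 2) ℝ}
    (h : HasGerm γ I t g) (ht : t ∈ I) :
    HasDerivWithinAt (fun s => (coord (γ t) (γ s) : ℂ)) (axisVelocity g t) I t :=
  (hasDerivAt_smul_axis g t).hasDerivWithinAt.congr_of_eventuallyEq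
    (Filter.Eventually.mono h fun s hs => by simp only [hs.2]) (by simp only [h.coord_self ht])

theorem HasGerm.velocity_eq {γ : ℝ → S} {I : Set ℝ} {t : ℝ} {g : GL (Fin 2) ℝ}
    (h : HasGerm γ I t g) (ht : t ∈ I) (hI : UniqueDiffWithinAt ℝ I t) :
    velocity γ I t = ⟨γ t, axisVelocity g t⟩ := by
  rw [velocity, (h.hasDerivWithinAt ht).derivWithin hI]

theorem HasGerm.comp_add {γ : ℝ → S} {I J : Set ℝ} {t c : ℝ} {g k : GL (Fin 2) ℝ}
    (h : HasGerm γ I (c + t) g) (hJ : Set.MapsTo (fun s => c + s) J I)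
    (hk : ∀ s, g • axis (c + s) = k • axis s) : HasGerm (fun s => γ (c + s)) J t k := by
  have hc : Filter.Tendsto (fun s => c + s) (𝓝[J] t) (𝓝[I] (c + t)) :=
    (continuous_const.add continuous_id).continuousWithinAt.tendsto_nhdsWithin hJ
  filter_upwards [hc.eventually h] with s hs
  rwa [← hk]

theorem HasGerm.comp_sub {γ : ℝ → S} {I J : Set ℝ} {t c : ℝ} {g k : GL (Fin 2) ℝ}
    (h : HasGerm γ I (c - t) g) (hJ : Set.MapsTo (fun s => c - s) J I)
    (hk : ∀ s, g • axis (c - s) = k • axis s) : HasGerm (fun s => γ (c - s)) J t k := by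
  have hc : Filter.Tendsto (fun s => c - s) (𝓝[J] t) (𝓝[I] (c - t)) :=
    (continuous_const.sub continuous_id).continuousWithinAt.tendsto_nhdsWithin hJ
  filter_upwards [hc.eventually h] with s hs
  rwa [← hk]

theorem IsGeodesicOn.comp_add {γ : ℝ → S} {I J : Set ℝ} {c : ℝ} (h : IsGeodesicOn γ I)
    (hJ : Set.MapsTo (fun s => c + s) J I) : IsGeodesicOn (fun s => γ (c + s)) J := by
  intro t ht
  obtain ⟨g, hg⟩ := h.exists_hasGerm (hJ ht)
  obtain ⟨k, hk⟩ := exists_smul_axis_add g c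
  exact ⟨k, hg.comp_add hJ hk⟩

theorem IsGeodesicOn.comp_sub {γ : ℝ → S} {I J : Set ℝ} {c : ℝ} (h : IsGeodesicOn γ I)
    (hJ : Set.MapsTo (fun s => c - s) J I) : IsGeodesicOn (fun s => γ (c - s)) J := by
  intro t ht
  obtain ⟨g, hg⟩ := h.exists_hasGerm (hJ ht)
  obtain ⟨k, hk⟩ := exists_smul_axis_sub g c
  exact ⟨k, hg.comp_sub hJ hk⟩

theorem axisVelocity_add {g k : GL (Fin 2) ℝ} {c : ℝ}
    (hk : ∀ s, g • axis (c + s) = k • axis s) (t : ℝ) :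
    axisVelocity k t = axisVelocity g (c + t) := by
  have h := (hasDerivAt_smul_axis g (c + t)).comp_const_add c t
  simp only [hk] at h
  exact h.deriv

theorem axisVelocity_sub {g k : GL (Fin 2) ℝ} {c : ℝ}
    (hk : ∀ s, g • axis (c - s) = k • axis s) (t : ℝ) :
    axisVelocity k t = -axisVelocity g (c - t) := by
  have h := (hasDerivAt_smul_axis g (c - t)).comp_const_sub c t
  simp only [hk] at h
  exact h.deriv

/-! ### Unique continuation, boundary contact and prolongation -/

/-- Propagation along an interval of a property that holds near every time at which it
accumulates. -/
theorem forall_mem_Icc_of_frequently {a b t₀ : ℝ} {P : ℝ → Prop} (ht₀ : t₀ ∈ Set.Icc a b)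
    (h₀ : ∀ᶠ s in 𝓝[Set.Icc a b] t₀, P s)
    (step : ∀ t ∈ Set.Icc a b, (∃ᶠ s in 𝓝[Set.Icc a b \ {t}] t, P s) →
      ∀ᶠ s in 𝓝[Set.Icc a b] t, P s) : ∀ t ∈ Set.Icc a b, P t := by
  set I := Set.Icc a b
  -- Connectedness: `u` is where `P` holds nearby, `v` where no nearby time is in `u`. Both are open
  -- and `step` makes them cover the interval.
  set u : Set ℝ := {t | ∀ᶠ s in 𝓝 t, s ∈ I → P s} with hu
  set v : Set ℝ := {t | ∀ᶠ s in 𝓝 t, s ∈ I → s ∉ u} with hv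
  have huo : IsOpen u := isOpen_setOfPred_eventually_nhds
  have hvo : IsOpen v := isOpen_setOfPred_eventually_nhds
  have hcov : ∀ t ∈ I, t ∈ u ∨ t ∈ v := by
    intro t ht
    by_cases hf : ∃ᶠ s in 𝓝[I \ {t}] t, P s
    · exact Or.inl (eventually_nhdsWithin_iff.1 (step t ht hf))
    · by_cases htu : t ∈ u
      · exact Or.inl htu
      · right
        rw [Filter.not_frequently, eventually_nhdsWithin_iff] at hf
        filter_upwards [hf] with s hs hsI hsu
        by_cases hst : s = t
        · exact htu (hst ▸ hsu)
        · exact hs ⟨hsI, hst⟩ (hsu.self_of_nhds hsI)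
  intro t ht
  by_contra hPt
  have htv : t ∈ v := (hcov t ht).resolve_left fun h => hPt (h.self_of_nhds ht)
  obtain ⟨x, hxI, hxu, hxv⟩ := isPreconnected_Icc u v huo hvo hcov
    ⟨t₀, ht₀, eventually_nhdsWithin_iff.1 h₀⟩ ⟨t, ht, htv⟩
  exact hxv.self_of_nhds hxI hxu

/-- Two geodesic paths with a common position and velocity at one time agree. -/
theorem eqOn_of_velocity_eq [T2Space S] {γ β : ℝ → S} {a b t₀ : ℝ} {g k : GL (Fin 2) ℝ}
    (hγ : IsGeodesicOn γ (Set.Icc a b)) (hβ : IsGeodesicOn β (Set.Icc a b))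
    (ht₀ : t₀ ∈ Set.Icc a b) (hp : γ t₀ = β t₀) (hg : HasGerm γ (Set.Icc a b) t₀ g)
    (hk : HasGerm β (Set.Icc a b) t₀ k) (hv : axisVelocity g t₀ = axisVelocity k t₀) :
    Set.EqOn γ β (Set.Icc a b) := by
  have aux : ∀ (t : ℝ) (g k : GL (Fin 2) ℝ), γ t = β t → HasGerm γ (Set.Icc a b) t g →
      HasGerm β (Set.Icc a b) t k → (∀ u, g • axis u = k • axis u) →
      ∀ᶠ s in 𝓝[Set.Icc a b] t, γ s = β s := by
    intro t g k hp hg hk h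
    filter_upwards [hg, hk] with s hs1 hs2
    rw [← hp] at hs2
    exact eq_of_coord_eq hs1.1 hs2.1 (by rw [hs1.2, hs2.2, h])
  refine forall_mem_Icc_of_frequently ht₀ (aux t₀ g k hp hg hk fun u =>
    smul_axis_eq_of_velocity_eq ?_ hv u) fun t ht hf => ?_
  · rw [← hg.coord_self ht₀, ← hk.coord_self ht₀, hp]
  · obtain ⟨g', hg'⟩ := hγ.exists_hasGerm ht
    obtain ⟨k', hk'⟩ := hβ.exists_hasGerm ht
    have hle : 𝓝[Set.Icc a b \ {t}] t ≤ 𝓝[Set.Icc a b] t := nhdsWithin_mono t Set.sdiff_subset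
    have hpt : γ t = β t := tendsto_nhds_unique_of_frequently_eq
      ((hγ.continuousOn t ht).mono_left hle) ((hβ.continuousOn t ht).mono_left hle) hf
    refine aux t g' k' hpt hg' hk' ?_
    -- The germs agree at `t` and at a second time `s`, with the same parameters, so they agree
    -- throughout.
    obtain ⟨s, ⟨hs, hs1, hs2⟩, hsI⟩ := ((hf.and_eventually
      ((hg'.filter_mono hle).and (hk'.filter_mono hle))).and_eventually self_mem_nhdsWithin).exists
    refine smul_axis_eq_of_eq_of_eq (s := t) (t := s) (fun h => hsI.2 h.symm) ?_ ?_
    · rw [← hg'.coord_self ht, ← hk'.coord_self ht, hpt]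
    · rw [← hs1.2, ← hs2.2, hs, hpt]

/-- A geodesic path that meets the boundary at an inner time lies in the boundary near this
time. -/
theorem HasGerm.re_eq_zero [HyperbolicSurface S] {γ : ℝ → S} {I : Set ℝ} {t : ℝ}
    {g : GL (Fin 2) ℝ} (hg : HasGerm γ I t g) (hI : I ∈ 𝓝 t) (ht : γ t ∈ bdry S) (u : ℝ) :
    (g • axis u).re = 0 := by
  have h1 := hg.re_nonneg
  have h2 := (hg.mem_bdry_iff.self_of_nhdsWithin (mem_of_mem_nhds hI)).1 ht
  rw [nhdsWithin_eq_nhds.2 hI] at h1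
  exact re_smul_axis_eq_zero_of_nonneg h2 h1 u

/-- A geodesic path that lies in the boundary near some time lies in the boundary. -/
theorem IsGeodesicOn.mem_bdry_of_eventually [HyperbolicSurface S] {γ : ℝ → S} {a b t₀ : ℝ}
    (hγ : IsGeodesicOn γ (Set.Icc a b)) (ht₀ : t₀ ∈ Set.Icc a b)
    (h : ∀ᶠ s in 𝓝[Set.Icc a b] t₀, γ s ∈ bdry S) : ∀ t ∈ Set.Icc a b, γ t ∈ bdry S := by
  refine forall_mem_Icc_of_frequently ht₀ h fun t ht hf => ?_
  obtain ⟨g, hg⟩ := hγ.exists_hasGerm ht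
  have hle : 𝓝[Set.Icc a b \ {t}] t ≤ 𝓝[Set.Icc a b] t := nhdsWithin_mono t Set.sdiff_subset
  have hf' := (hf.and_eventually (hg.mem_bdry_iff.filter_mono hle)).and_eventually
    self_mem_nhdsWithin
  obtain ⟨r, ⟨hr, hr'⟩, hrI⟩ := hf'.exists
  -- A second boundary time, different from `r`, puts the whole germ on the boundary line.
  have hne : ∀ᶠ s in 𝓝[Set.Icc a b \ {t}] t, s ≠ r :=
    nhdsWithin_le_nhds (isOpen_ne.mem_nhds fun h => hrI.2 h.symm)
  obtain ⟨s, ⟨⟨hs, hs'⟩, -⟩, hsr⟩ := (hf'.and_eventually hne).exists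
  obtain ⟨c, hc⟩ := smul_axis_eq_axis_of_re_eq_zero hsr (hs'.1 hs) (hr'.1 hr)
  filter_upwards [hg.mem_bdry_iff] with u hu
  rw [hu]
  rcases hc with hc | hc <;> rw [hc, axis_re]

/-- Contact at an inner time is tangential, because the surface lies on one side of the boundary
line; the contact then propagates along the path. -/
theorem IsGeodesicOn.mem_bdry_of_mem_Ioo [HyperbolicSurface S] {γ : ℝ → S} {a b t₀ : ℝ}
    (hγ : IsGeodesicOn γ (Set.Icc a b)) (ht₀ : t₀ ∈ Set.Ioo a b) (h : γ t₀ ∈ bdry S) :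
    ∀ t ∈ Set.Icc a b, γ t ∈ bdry S := by
  obtain ⟨g, hg⟩ := hγ.exists_hasGerm (Set.Ioo_subset_Icc_self ht₀)
  refine hγ.mem_bdry_of_eventually (Set.Ioo_subset_Icc_self ht₀) ?_
  filter_upwards [hg.mem_bdry_iff] with s hs
  exact hs.2 (hg.re_eq_zero (Icc_mem_nhds ht₀.1 ht₀.2) h s)

/-- A geodesic path that ends at an inner point of the surface can be prolonged. -/
theorem IsGeodesicOn.exists_extension [HyperbolicSurface S] {γ : ℝ → S} {a b : ℝ} (hab : a ≤ b)
    (hγ : IsGeodesicOn γ (Set.Icc a b)) (hb : γ b ∉ bdry S) :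
    ∃ c > b, ∃ β : ℝ → S, Set.EqOn β γ (Set.Icc a b) ∧ IsGeodesicOn β (Set.Icc a c) := by
  have hbI : b ∈ Set.Icc a b := Set.right_mem_Icc.2 hab
  obtain ⟨g, hg⟩ := hγ.exists_hasGerm hbI
  set e := chartAt HalfPlane (γ b) with he
  have hpos : 0 < (g • axis b).re := by
    rw [← hg.coord_self hbI]
    exact lt_of_le_of_ne (coord_re_nonneg _ _) (Ne.symm hb)
  have hgb : toHalf (g • axis b) = e (γ b) := by
    rw [← hg.coord_self hbI]
    exact toHalf_coe _
  have hcont : Continuous fun s => toHalf (g • axis s) :=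
    continuous_toHalf.comp (continuous_smul_axis g)
  have hev : ∀ᶠ s in 𝓝 b, 0 < (g • axis s).re ∧ toHalf (g • axis s) ∈ e.target := by
    refine ((UpperHalfPlane.continuous_re.comp (continuous_smul_axis g)).continuousAt.eventually
      (lt_mem_nhds hpos)).and (hcont.continuousAt.eventually (e.open_target.mem_nhds ?_))
    change toHalf (g • axis b) ∈ e.target
    rw [hgb]
    exact e.map_source (mem_chart_source _ _)
  obtain ⟨ε, hε, hball⟩ := Metric.eventually_nhds_iff.1 hev
  -- Beyond `b` the path follows the germ `g` in the chart at `γ b`; `toHalf` only makes the formula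
  -- total, as the real part is positive near `b`.
  set β : ℝ → S := fun s => if s ≤ b then γ s else e.symm (toHalf (g • axis s)) with hβ
  have hβγ : ∀ s ≤ b, β s = γ s := fun s hs => if_pos hs
  have hβe : ∀ s, b < s → s < b + ε → β s ∈ e.source ∧ coord (γ b) (β s) = g • axis s := by
    intro s hs hs'
    obtain ⟨h1, h2⟩ := hball (y := s) (by rw [Real.dist_eq, abs_lt]; constructor <;> linarith)
    have : β s = e.symm (toHalf (g • axis s)) := if_neg (not_le.2 hs)
    rw [this]
    refine ⟨e.map_target h2, ?_⟩
    rw [coord, ← he, e.right_inv h2, coe_toHalf h1.le]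
  refine ⟨b + ε / 2, by linarith, β, fun s hs => hβγ s hs.2, fun t ht => ?_⟩
  rcases lt_trichotomy t b with htb | rfl | htb
  · obtain ⟨k, hk⟩ := hγ t ⟨ht.1, htb.le⟩
    refine ⟨k, ?_⟩
    have hk' := eventually_nhdsWithin_iff.1 hk
    filter_upwards [self_mem_nhdsWithin, nhdsWithin_le_nhds hk',
      nhdsWithin_le_nhds (Iio_mem_nhds htb)] with s hs1 hs2 hs3
    rw [hβγ t htb.le, hβγ s (le_of_lt hs3)]
    exact hs2 ⟨hs1.1, le_of_lt hs3⟩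
  · refine ⟨g, ?_⟩
    filter_upwards [self_mem_nhdsWithin, nhdsWithin_le_nhds (eventually_nhdsWithin_iff.1 hg)]
      with s hs1 hs2
    rw [hβγ t le_rfl]
    rcases le_or_gt s t with hst | hst
    · rw [hβγ s hst]
      exact hs2 ⟨hs1.1, hst⟩
    · exact hβe s hst (by linarith [hs1.2])
  · refine exists_hasGerm_of_coord (p := γ b) (g := g) ht ?_
    filter_upwards [self_mem_nhdsWithin, nhdsWithin_le_nhds (Ioi_mem_nhds htb)] with s hs1 hs2
    exact hβe s hs2 (by linarith [hs1.2])

/-! ### Rays of a tangent vector -/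

theorem IsRay.axisVelocity_eq {v : TangentVec S} {γ : ℝ → S} {T : ℝ} (h : IsRay v γ T)
    (hT : 0 < T) {g : GL (Fin 2) ℝ} (hg : HasGerm γ (Set.Icc 0 T) 0 g) :
    axisVelocity g 0 = v.vec := by
  have h0 : (0 : ℝ) ∈ Set.Icc 0 T := ⟨le_rfl, hT.le⟩
  have := h.2.2 hT
  rw [hg.velocity_eq h0 (uniqueDiffOn_Icc hT 0 h0)] at this
  exact congrArg TangentVec.vec this

theorem isRay_of_hasGerm {v : TangentVec S} {γ : ℝ → S} {T : ℝ} (hb : γ 0 = v.base)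
    (hγ : IsGeodesicOn γ (Set.Icc 0 T)) {g : GL (Fin 2) ℝ} (hg : HasGerm γ (Set.Icc 0 T) 0 g)
    (hv : axisVelocity g 0 = v.vec) : IsRay v γ T := by
  refine ⟨hb, hγ, fun hT => ?_⟩
  have h0 : (0 : ℝ) ∈ Set.Icc 0 T := ⟨le_rfl, hT.le⟩
  rw [hg.velocity_eq h0 (uniqueDiffOn_Icc hT 0 h0), hb, hv]

theorem IsRay.mono {v : TangentVec S} {γ : ℝ → S} {T T' : ℝ} (h : IsRay v γ T)
    (h0 : 0 ≤ T') (hT : T' ≤ T) : IsRay v γ T' := by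
  rcases h0.eq_or_lt with rfl | hpos
  · exact ⟨h.1, h.2.1.mono (Set.Icc_subset_Icc_right hT), fun h => absurd h (lt_irrefl _)⟩
  · obtain ⟨g, hg⟩ := h.2.1.exists_hasGerm (t := 0) ⟨le_rfl, h0.trans hT⟩
    exact isRay_of_hasGerm h.1 (h.2.1.mono (Set.Icc_subset_Icc_right hT))
      (hg.mono (Set.Icc_subset_Icc_right hT)) (h.axisVelocity_eq (hpos.trans_le hT) hg)

/-- The ray with a given initial velocity is unique. -/
theorem IsRay.eq [T2Space S] {v : TangentVec S} {γ β : ℝ → S} {T : ℝ} (hT : 0 ≤ T)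
    (h : IsRay v γ T) (h' : IsRay v β T) : γ T = β T := by
  rcases hT.eq_or_lt with rfl | hpos
  · rw [h.1, h'.1]
  · have h0 : (0 : ℝ) ∈ Set.Icc 0 T := ⟨le_rfl, hT⟩
    obtain ⟨g, hg⟩ := h.2.1.exists_hasGerm h0
    obtain ⟨k, hk⟩ := h'.2.1.exists_hasGerm h0
    exact eqOn_of_velocity_eq h.2.1 h'.2.1 h0 (h.1.trans h'.1.symm) hg hk
      ((h.axisVelocity_eq hpos hg).trans (h'.axisVelocity_eq hpos hk).symm) ⟨hT, le_rfl⟩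

theorem IsRay.ray_eq [T2Space S] {v : TangentVec S} {γ : ℝ → S} {T : ℝ} (hT : 0 ≤ T)
    (h : IsRay v γ T) : ray v T = γ T := by
  have hex : ∃ γ : ℝ → S, IsRay v γ T := ⟨γ, h⟩
  rw [ray, dif_pos hex]
  exact hex.choose_spec.eq hT h

/-- The forward ray of the velocity of a geodesic path follows this path. -/
theorem IsGeodesicOn.isRay_forward {γ : ℝ → S} {a b t s : ℝ} (hab : a < b)
    (hγ : IsGeodesicOn γ (Set.Icc a b)) (ht : t ∈ Set.Icc a b) (hs : s ≤ b - t) :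
    IsRay (velocity γ (Set.Icc a b) t) (fun r => γ (t + r)) s := by
  obtain ⟨g, hg⟩ := hγ.exists_hasGerm ht
  obtain ⟨k, hk⟩ := exists_smul_axis_add g t
  have hm : Set.MapsTo (fun r => t + r) (Set.Icc 0 s) (Set.Icc a b) := fun r hr =>
    ⟨by linarith [ht.1, hr.1], by linarith [hr.2]⟩
  rw [hg.velocity_eq ht (uniqueDiffOn_Icc hab t ht)]
  refine isRay_of_hasGerm (by simp) (hγ.comp_add hm)
    (HasGerm.comp_add (by simpa using hg) hm hk) ?_
  rw [axisVelocity_add hk, add_zero]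

/-- The backward ray of the velocity of a geodesic path follows the reversed path. -/
theorem IsGeodesicOn.isRay_backward {γ : ℝ → S} {a b t s : ℝ} (hab : a < b)
    (hγ : IsGeodesicOn γ (Set.Icc a b)) (ht : t ∈ Set.Icc a b) (hs : s ≤ t - a) :
    IsRay (-velocity γ (Set.Icc a b) t) (fun r => γ (t - r)) s := by
  obtain ⟨g, hg⟩ := hγ.exists_hasGerm ht
  obtain ⟨k, hk⟩ := exists_smul_axis_sub g t
  have hm : Set.MapsTo (fun r => t - r) (Set.Icc 0 s) (Set.Icc a b) := fun r hr =>
    ⟨by linarith [hr.2], by linarith [ht.2, hr.1]⟩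
  rw [hg.velocity_eq ht (uniqueDiffOn_Icc hab t ht)]
  refine isRay_of_hasGerm (by simp; rfl) (hγ.comp_sub hm)
    (HasGerm.comp_sub (by simpa using hg) hm hk) ?_
  rw [axisVelocity_sub hk, sub_zero]
  rfl

/-- The backward ray of the velocity of a geodesic path that starts at the boundary, and does not
lie in it, exists only until it reaches the starting point. -/
theorem IsGeodesicOn.rayDomain_backward [T2Space S] [HyperbolicSurface S] {γ : ℝ → S}
    {a b t x : ℝ} (hab : a < b) (hγ : IsGeodesicOn γ (Set.Icc a b)) (ht : t ∈ Set.Icc a b)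
    (ha : γ a ∈ bdry S) (hx : x ∈ Set.Icc a b) (hxb : γ x ∉ bdry S) :
    rayDomain (-velocity γ (Set.Icc a b) t) = Set.Icc 0 (t - a) := by
  refine Set.Subset.antisymm ?_ fun s hs => ⟨hs.1, _, hγ.isRay_backward hab ht hs.2⟩
  rintro s ⟨hs0, β, hβ⟩
  refine ⟨hs0, ?_⟩
  by_contra! hlt
  rcases ht.1.eq_or_lt with rfl | hat
  -- A ray leaving backward from the boundary point would make the germ of `γ` lie in `0 ≤ re z` on
  -- both sides of `a`, hence in the boundary line.
  · rw [sub_self] at hlt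
    have hs0' : (0 : ℝ) ∈ Set.Icc 0 s := ⟨le_rfl, hs0⟩
    obtain ⟨g, hg⟩ := hγ.exists_hasGerm ht
    obtain ⟨k, hk⟩ := exists_smul_axis_sub g a
    obtain ⟨k', hk'⟩ := hβ.2.1.exists_hasGerm hs0'
    have hbase : β 0 = γ a := hβ.1
    have hvel : axisVelocity k' 0 = axisVelocity k 0 := by
      rw [hβ.axisVelocity_eq hlt hk', hg.velocity_eq ht (uniqueDiffOn_Icc hab a ht),
        axisVelocity_sub hk, sub_zero]
      rfl
    have hpos : k' • axis 0 = k • axis 0 := by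
      rw [← hk, sub_zero, ← hg.coord_self ht, ← hk'.coord_self hs0', hbase]
    have heq := smul_axis_eq_of_velocity_eq hpos hvel
    have h1 : ∀ᶠ u in 𝓝[≥] a, 0 ≤ (g • axis u).re := by
      rw [← nhdsWithin_Icc_eq_nhdsGE hab]
      exact hg.re_nonneg
    have h2 : ∀ᶠ u in 𝓝[≤] a, 0 ≤ (g • axis u).re := by
      have h3 := hk'.re_nonneg
      rw [nhdsWithin_Icc_eq_nhdsGE hlt] at h3
      have hc : Filter.Tendsto (fun u => a - u) (𝓝[≤] a) (𝓝[≥] 0) := by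
        have : ContinuousWithinAt (fun u : ℝ => a - u) (Set.Iic a) a := by fun_prop
        have h4 := this.tendsto_nhdsWithin (t := Set.Ici 0) fun u (hu : u ≤ a) =>
          sub_nonneg.2 hu
        rwa [sub_self] at h4
      filter_upwards [hc.eventually h3] with u hu
      rwa [heq, ← hk, sub_sub_cancel] at hu
    have h5 : ∀ᶠ u in 𝓝 a, 0 ≤ (g • axis u).re := by
      rw [← nhdsLE_sup_nhdsGE]
      exact Filter.eventually_sup.2 ⟨h2, h1⟩
    have h6 := re_smul_axis_eq_zero_of_nonneg
      ((hg.mem_bdry_iff.self_of_nhdsWithin ht).1 ha) h5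
    exact hxb (hγ.mem_bdry_of_eventually ht (hg.mem_bdry_iff.mono fun u hu => hu.2 (h6 u)) x hx)
  -- A longer ray `β` would follow `γ` back to `γ a` and meet the boundary at an inner time of its
  -- own.
  · have hβγ : ∀ u, 0 ≤ u → u ≤ t - a → β u = γ (t - u) := fun u hu0 hu =>
      (hβ.mono hu0 (hu.trans hlt.le)).eq hu0 (hγ.isRay_backward hab ht hu)
    have hβb := hβ.2.1.mem_bdry_of_mem_Ioo (t₀ := t - a) ⟨by linarith, hlt⟩ (by
      rw [hβγ _ (by linarith) le_rfl, sub_sub_cancel]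
      exact ha)
    have hmid := hβb ((t - a) / 2) ⟨by linarith, by linarith⟩
    rw [hβγ _ (by linarith) (by linarith)] at hmid
    exact hxb (hγ.mem_bdry_of_mem_Ioo (t₀ := t - (t - a) / 2)
      ⟨by linarith, by linarith [ht.2]⟩ hmid x hx)

/-! ### Double points and prolongation of a lasso -/

variable {α : ℝ → S} {T₁ T₂ T₃ : ℝ}

/-- The two strands of a lasso at its knot are not the same geodesic. -/
theorem IsPositiveLasso.not_forall_germ_eq (hα : IsPositiveLasso α T₁ T₂ T₃) (hT : T₁ < T₃)
    {g h : GL (Fin 2) ℝ} (hg : HasGerm α (Set.Icc T₁ T₂) T₃ g)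
    (hh : HasGerm α (Set.Icc T₁ T₂) T₂ h) (σ : ℝ) :
    ¬ ∀ u, h • axis (T₂ + u) = g • axis (T₃ + σ * u) := by
  intro H
  have hlt := hα.lt
  have hc : Filter.Tendsto (fun u => T₃ + σ * u) (𝓝[<] 0) (𝓝 T₃) := by
    have : Continuous fun u => T₃ + σ * u := by fun_prop
    simpa using (this.tendsto 0).mono_left nhdsWithin_le_nhds
  have hc' : Filter.Tendsto (fun u => T₂ + u) (𝓝[<] 0) (𝓝 T₂) := by
    have : Continuous fun u => T₂ + u := by fun_prop
    simpa using (this.tendsto 0).mono_left nhdsWithin_le_nhds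
  -- Only `u < 0` is available, since `α` is a geodesic only up to `T₂`. For small `u` the two times
  -- are distinct and in `(T₁, T₂)`, against injectivity.
  have hd : ∀ᶠ u in 𝓝[<] (0 : ℝ), T₃ + σ * u < T₂ + u := hc.eventually_lt hc' hlt
  obtain ⟨u, h1, h2, h3, h4, h5, h6, h7⟩ := ((hc.eventually (eventually_nhdsWithin_iff.1 hg)).and
    ((hc'.eventually (eventually_nhdsWithin_iff.1 hh)).and (hd.and
    ((hc.eventually (Ioi_mem_nhds hT)).and ((hc.eventually (Iio_mem_nhds hlt)).and
    ((hc'.eventually (Ioi_mem_nhds (hT.trans hlt))).and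
    (self_mem_nhdsWithin (a := (0 : ℝ)) (s := Set.Iio 0)))))))).exists
  have h7 : u < 0 := h7
  have e1 := h1 ⟨h4.le, h5.le⟩
  have e2 := h2 ⟨h6.le, by linarith⟩
  rw [hα.knot] at e1
  have := hα.injOn ⟨h4, h5⟩ ⟨h6, by linarith⟩
    (eq_of_coord_eq e1.1 e2.1 (by rw [e1.2, e2.2, H]))
  linarith

/-- The two strands of a lasso at its knot have no other common point. -/
theorem IsPositiveLasso.germ_ne (hα : IsPositiveLasso α T₁ T₂ T₃) (hT : T₁ < T₃)
    {g h : GL (Fin 2) ℝ} (hg : HasGerm α (Set.Icc T₁ T₂) T₃ g)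
    (hh : HasGerm α (Set.Icc T₁ T₂) T₂ h) {s t : ℝ} (hs : s ≠ T₂) :
    h • axis s ≠ g • axis t := by
  intro H
  have hlt := hα.lt
  have h0 : h • axis T₂ = g • axis T₃ := by
    rw [← hh.coord_self ⟨by linarith, le_rfl⟩, ← hg.coord_self ⟨hT.le, hlt.le⟩, hα.knot]
  rcases smul_axis_eq_of_two_points hs.symm h0 H with h1 | h1
  · exact hα.not_forall_germ_eq hT hg hh 1 (by simpa using h1)
  · exact hα.not_forall_germ_eq hT hg hh (-1) fun u => by rw [h1, neg_one_mul, sub_eq_add_neg]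

/-- Otherwise the whole lasso lies in the boundary. The germ at `T₃` then sweeps out the full
boundary line and so meets the strand arriving at `T₂` again, against `germ_ne`. -/
theorem IsPositiveLasso.knot_notMem_bdry [HyperbolicSurface S]
    (hα : IsPositiveLasso α T₁ T₂ T₃) (hT : T₁ < T₃) : α T₃ ∉ bdry S := by
  intro hb
  have hlt := hα.lt
  have h2I : T₂ ∈ Set.Icc T₁ T₂ := ⟨by linarith, le_rfl⟩
  obtain ⟨g, hg⟩ := hα.geodesic.exists_hasGerm (t := T₃) ⟨hT.le, hlt.le⟩
  obtain ⟨h, hh⟩ := hα.geodesic.exists_hasGerm h2I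
  have hall := hα.geodesic.mem_bdry_of_mem_Ioo ⟨hT, hlt⟩ hb
  have hg0 := hg.re_eq_zero (Icc_mem_nhds hT hlt) hb
  obtain ⟨c, hc⟩ := smul_axis_eq_axis_of_re_eq_zero hlt.ne (hg0 T₃) (hg0 T₂)
  have hev : ∀ᶠ s in 𝓝[<] T₂, (h • axis s).re = 0 := by
    have h1 := hh.mem_bdry_iff
    rw [nhdsWithin_Icc_eq_nhdsLE (hT.trans hlt)] at h1
    filter_upwards [nhdsWithin_mono _ Set.Iio_subset_Iic_self h1,
      Ioo_mem_nhdsLT (hT.trans hlt)] with s hs hsI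
    exact hs.1 (hall s ⟨hsI.1.le, hsI.2.le⟩)
  obtain ⟨s, hs, hs2⟩ := (hev.and (self_mem_nhdsWithin (a := T₂) (s := Set.Iio T₂))).exists
  obtain ⟨c', hc'⟩ := smul_axis_eq_axis_of_re_eq_zero (g := h) (ne_of_lt hs2) hs
    ((hh.mem_bdry_iff.self_of_nhdsWithin h2I).1 (hα.knot ▸ hb))
  have hx : ∃ x, h • axis s = axis x := by
    rcases hc' with hc' | hc' <;> exact ⟨_, hc' s⟩
  obtain ⟨x, hx⟩ := hx
  rcases hc with hc | hc
  · exact hα.germ_ne hT hg hh (ne_of_lt hs2) (t := x - c) (by rw [hx, hc, add_sub_cancel])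
  · exact hα.germ_ne hT hg hh (ne_of_lt hs2) (t := c - x) (by rw [hx, hc, sub_sub_cancel])

/-- A lasso whose knot is not its base point meets the boundary only at its base point. -/
theorem IsPositiveLasso.notMem_bdry [HyperbolicSurface S] (hα : IsPositiveLasso α T₁ T₂ T₃)
    (hT : T₁ < T₃) {s : ℝ} (hs : s ∈ Set.Ioc T₁ T₂) : α s ∉ bdry S := by
  intro hb
  have hk := hα.knot_notMem_bdry hT
  rcases hs.2.eq_or_lt with rfl | hlt
  · exact hk (hα.knot ▸ hb)
  · exact hk (hα.geodesic.mem_bdry_of_mem_Ioo ⟨hs.1, hlt⟩ hb T₃ ⟨hα.le, hα.lt.le⟩)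

/-- The knot is the only double point of a lasso. -/
theorem IsPositiveLasso.eq_knot [HyperbolicSurface S] (hα : IsPositiveLasso α T₁ T₂ T₃)
    (hT : T₁ < T₃) {x y : ℝ} (hx : T₁ ≤ x) (hxy : x < y) (hy : y ≤ T₂) (h : α x = α y) :
    x = T₃ ∧ y = T₂ := by
  have hx1 : T₁ < x := by
    refine lt_of_le_of_ne hx ?_
    rintro rfl
    exact hα.notMem_bdry hT ⟨hxy, hy⟩ (h ▸ hα.base_mem)
  rcases hy.eq_or_lt with rfl | hlt
  · rw [← hα.knot] at h
    exact ⟨hα.injOn ⟨hx1, hxy⟩ ⟨hT, hα.lt⟩ h, rfl⟩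
  · exact absurd (hα.injOn ⟨hx1, hxy.trans hlt⟩ ⟨hx1.trans hxy, hlt⟩ h) hxy.ne

theorem HasGerm.eventually_injective {γ : ℝ → S} {I : Set ℝ} {t : ℝ} {g : GL (Fin 2) ℝ}
    (hg : HasGerm γ I t g) (hI : I ∈ 𝓝 t) :
    ∀ᶠ z in 𝓝 t ×ˢ 𝓝 t, γ z.1 = γ z.2 → z.1 = z.2 := by
  rw [HasGerm, nhdsWithin_eq_nhds.2 hI] at hg
  filter_upwards [hg.prod_mk hg] with z hz h
  exact smul_axis_injective g (hz.1.2.symm.trans ((congrArg _ h).trans hz.2.2))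

/-- A lasso can be prolonged beyond its knot by an arc that does not meet it again. -/
theorem IsPositiveLasso.exists_extension [T2Space S] [HyperbolicSurface S]
    (hα : IsPositiveLasso α T₁ T₂ T₃) (hT : T₁ < T₃) :
    ∃ T > T₂, ∃ β : ℝ → S, Set.EqOn β α (Set.Icc T₁ T₂) ∧ IsGeodesicOn β (Set.Icc T₁ T) ∧
      (∀ x y, T₁ ≤ x → x < y → y ≤ T → β x = β y → x = T₃ ∧ y = T₂) ∧
      ∀ y ∈ Set.Ioc T₁ T, β y ∉ bdry S := by
  have hlt := hα.lt
  have h12 : T₁ < T₂ := hT.trans hlt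
  obtain ⟨c, hc, β, hβα, hβ⟩ := hα.geodesic.exists_extension h12.le
    (hα.notMem_bdry hT ⟨h12, le_rfl⟩)
  have hαβ : ∀ {s}, T₁ ≤ s → s ≤ T₂ → β s = α s := fun h h' => hβα ⟨h, h'⟩
  have hbdry : ∀ y ∈ Set.Ioo T₁ c, β y ∉ bdry S := by
    intro y hy hb
    have := hβ.mem_bdry_of_mem_Ioo hy hb T₂ ⟨h12.le, hc.le⟩
    rw [hαβ h12.le le_rfl] at this
    exact hα.notMem_bdry hT ⟨h12, le_rfl⟩ this
  have hI2 : Set.Icc T₁ c ∈ 𝓝 T₂ := Icc_mem_nhds h12 hc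
  have hI3 : Set.Icc T₁ c ∈ 𝓝 T₃ := Icc_mem_nhds hT (hlt.trans hc)
  obtain ⟨h, hh⟩ := hβ.exists_hasGerm (mem_of_mem_nhds hI2)
  obtain ⟨g, hg⟩ := hβ.exists_hasGerm (mem_of_mem_nhds hI3)
  have hsub : Set.Icc T₁ T₂ ⊆ Set.Icc T₁ c := Set.Icc_subset_Icc_right hc.le
  have hhα : HasGerm α (Set.Icc T₁ T₂) T₂ h := by
    have h1 := hh.mono hsub
    filter_upwards [h1, self_mem_nhdsWithin] with s hs hsI
    rwa [hαβ h12.le le_rfl, hβα hsI] at hs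
  have hgα : HasGerm α (Set.Icc T₁ T₂) T₃ g := by
    have h1 := hg.mono hsub
    filter_upwards [h1, self_mem_nhdsWithin] with s hs hsI
    rwa [hαβ hT.le hlt.le, hβα hsI] at hs
  have hknot : β T₃ = β T₂ := by rw [hαβ hT.le hlt.le, hαβ h12.le le_rfl, hα.knot]
  have hinj := hh.eventually_injective hI2
  -- Compactness in `x`: near `T₂` local injectivity applies, near `T₃` transversality of the
  -- strands, elsewhere Hausdorff separation. The repeated membership is needed because
  -- neighbourhoods of `x` may leave the interval.
  have hfar : ∀ᶠ y in 𝓝 T₂, ∀ x ∈ Set.Icc T₁ T₂, x ∈ Set.Icc T₁ T₂ → T₂ < y → β x ≠ β y := by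
    refine isCompact_Icc.eventually_forall_of_forall_eventually fun x hx => ?_
    rw [nhds_prod_eq]
    by_cases hxk : β x = β T₂
    · rcases hx.2.eq_or_lt with rfl | hx2
      · filter_upwards [hinj] with z hz hz1 hz2 heq
        have := hz heq.symm
        linarith [hz1.2]
      · obtain ⟨rfl, -⟩ := hα.eq_knot hT hx.1 hx2 le_rfl
          (by rwa [hαβ hx.1 hx.2, hαβ h12.le le_rfl] at hxk)
        have hg' := hg
        have hh' := hh
        rw [HasGerm, nhdsWithin_eq_nhds.2 hI3] at hg'
        rw [HasGerm, nhdsWithin_eq_nhds.2 hI2] at hh'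
        filter_upwards [hh'.prod_mk hg'] with z hz hz1 hz2 heq
        refine hα.germ_ne hT hgα hhα hz2.ne' (t := z.2) ?_
        rw [← hz.1.2, ← hz.2.2, hknot, heq]
    · obtain ⟨U, V, hU, hV, hxU, hyV, hUV⟩ := t2_separation hxk
      have h1 := hβ.continuousOn x (hsub hx) |>.eventually (hU.mem_nhds hxU)
      have h2 := hh.continuousWithinAt (mem_of_mem_nhds hI2) |>.eventually (hV.mem_nhds hyV)
      rw [nhdsWithin_eq_nhds.2 hI2] at h2
      filter_upwards [h2.prod_mk (eventually_nhdsWithin_iff.1 h1)] with z hz hz1 hz2 heq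
      exact Set.disjoint_left.1 hUV (hz.2 (hsub hz1)) (heq ▸ hz.1)
  obtain ⟨U, hU, hUinj⟩ := Filter.eventually_prod_self_iff
    (r := fun x y => β x = β y → x = y) |>.1 hinj
  obtain ⟨ε, hε, hball⟩ := Metric.eventually_nhds_iff.1
    (hfar.and ((Filter.eventually_mem_set.2 hU).and (Iio_mem_nhds hc)))
  have hnear : ∀ y, T₂ ≤ y → y ≤ T₂ + ε / 2 → dist y T₂ < ε := fun y h1 h2 => by
    rw [Real.dist_eq, abs_lt]
    constructor <;> linarith
  have hTc : T₂ + ε / 2 < c := (hball (hnear (T₂ + ε / 2) (by linarith) le_rfl)).2.2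
  refine ⟨T₂ + ε / 2, by linarith, β, hβα, hβ.mono (Set.Icc_subset_Icc_right hTc.le), ?_,
    fun y hy => hbdry y ⟨hy.1, hy.2.trans_lt hTc⟩⟩
  intro x y hx hxy hy heq
  rcases le_or_gt y T₂ with hy2 | hy2
  · exact hα.eq_knot hT hx hxy hy2 (by rwa [hαβ hx (by linarith), hαβ (by linarith) hy2] at heq)
  · have hy' := hball (hnear y hy2.le hy)
    rcases le_or_gt x T₂ with hx2 | hx2
    · exact absurd heq (hy'.1 x ⟨hx, hx2⟩ ⟨hx, hx2⟩ hy2)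
    · have hx' := hball (hnear x hx2.le (hxy.le.trans hy))
      exact absurd (hUinj x hx'.2.1 y hy'.2.1 heq) hxy.ne

/-- The velocity of a geodesic path does not depend on its domain. -/
theorem velocity_eq_of_eqOn {α β : ℝ → S} {a b c t : ℝ} (hab : a < b) (hbc : b ≤ c)
    (hβ : IsGeodesicOn β (Set.Icc a c)) (h : Set.EqOn β α (Set.Icc a b))
    (ht : t ∈ Set.Icc a b) : velocity α (Set.Icc a b) t = velocity β (Set.Icc a c) t := by
  have hsub : Set.Icc a b ⊆ Set.Icc a c := Set.Icc_subset_Icc_right hbc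
  obtain ⟨g, hg⟩ := hβ.exists_hasGerm (hsub ht)
  have hgα : HasGerm α (Set.Icc a b) t g := by
    filter_upwards [hg.mono hsub, self_mem_nhdsWithin] with s hs hsI
    rwa [h ht, h hsI] at hs
  rw [hgα.velocity_eq ht (uniqueDiffOn_Icc hab t ht),
    hg.velocity_eq (hsub ht) (uniqueDiffOn_Icc (hab.trans_le hbc) t (hsub ht)), h ht]

/-! ### Stopping times of the two rays -/

/-- The rays of the velocity `v` at time `t` of a lasso on `[T₁, T₂]` with knot at the times `T₃`
and `T₂`, where `β` is a prolongation of the lasso to `[T₁, T]` without further double points. -/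
structure LassoRays (β : ℝ → S) (v : TangentVec S) (T₁ T₂ T₃ T t : ℝ) : Prop where
  base_lt : T₁ < T₃
  lt : T₃ < T₂
  lt_end : T₂ < T
  mem : t ∈ Set.Icc T₁ T₂
  forward : ∀ s, 0 ≤ s → s ≤ T - t → s ∈ rayDomain v ∧ ray v s = β (t + s)
  rayDomain_backward : rayDomain (-v) = Set.Icc 0 (t - T₁)
  backward : ∀ s, 0 ≤ s → s ≤ t - T₁ → ray (-v) s = β (t - s)
  base_mem : β T₁ ∈ bdry S
  notMem_bdry : ∀ y ∈ Set.Ioc T₁ T, β y ∉ bdry S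
  knot : β T₃ = β T₂
  eq_knot : ∀ x y, T₁ ≤ x → x < y → y ≤ T → β x = β y → x = T₃ ∧ y = T₂

namespace LassoRays

variable {β : ℝ → S} {v : TangentVec S} {T₁ T₂ T₃ T t : ℝ}

/-- Along `β` the only possible event is the second visit to the knot. A self-hit forces `t ≤ T₃`; a
hit on the backward ray forces `t - T₃ ≤ T₂ - t`. -/
theorem forward_hit (H : LassoRays β v T₁ T₂ T₃ T t) {s : ℝ} {τ : EReal} (hs : s ∈ rayDomain v)
    (hsT : s < T - t)
    (hhit : HitsBdry v s ∨ HitsSelf v s ∨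
      (0 < s ∧ ∃ r ∈ Set.Icc 0 s ∩ rayDomain (-v), (r : EReal) ≤ τ ∧ ray (-v) r = ray v s)) :
    s = T₂ - t ∧ t ≤ (T₂ + T₃) / 2 := by
  have h1 := H.base_lt
  have h2 := H.lt
  have h3 := H.lt_end
  obtain ⟨ht1, ht2⟩ := H.mem
  have hs0 : 0 ≤ s := hs.1
  have hray := (H.forward s hs0 hsT.le).2
  rcases hhit with (⟨hpos, hb⟩ | hmax) | ⟨r, hr, heq⟩ | ⟨hpos, r, ⟨hr, hrd⟩, -, heq⟩
  · rw [hray] at hb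
    exact absurd hb (H.notMem_bdry _ ⟨by linarith, by linarith⟩)
  · have := hmax _ (H.forward (T - t) (by linarith) le_rfl).1
    linarith
  · rw [hray, (H.forward r hr.1 (by linarith [hr.2])).2] at heq
    obtain ⟨e1, e2⟩ := H.eq_knot _ _ (by linarith [hr.1]) (by linarith [hr.2]) (by linarith) heq
    constructor <;> linarith [hr.1]
  · rw [H.rayDomain_backward] at hrd
    rw [hray, H.backward r hr.1 hrd.2] at heq
    obtain ⟨e1, e2⟩ := H.eq_knot _ _ (by linarith [hrd.2]) (by linarith [hr.1]) (by linarith) heq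
    constructor <;> linarith [hr.2]

theorem stopForward_eq (H : LassoRays β v T₁ T₂ T₃ T t) (hmid : t ≤ (T₂ + T₃) / 2) {τ : EReal}
    (hτ : ((t - T₁ : ℝ) : EReal) ≤ τ) : stopForward v τ = ((T₂ - t : ℝ) : EReal) := by
  have h1 := H.base_lt
  have h2 := H.lt
  have h3 := H.lt_end
  obtain ⟨ht1, ht2⟩ := H.mem
  have hF := H.forward (T₂ - t) (by linarith) (by linarith)
  refine le_antisymm (sInf_le ⟨T₂ - t, ⟨hF.1, Or.inr ?_⟩, rfl⟩) (le_sInf ?_)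
  -- The knot was drawn by the forward ray at time `T₃ - t`, or by the backward ray at time `t -
  -- T₃`, before it can be frozen.
  · rcases le_or_gt t T₃ with ht3 | ht3
    · refine Or.inl ⟨T₃ - t, ⟨by linarith, by linarith⟩, ?_⟩
      rw [hF.2, (H.forward (T₃ - t) (by linarith) (by linarith)).2, add_sub_cancel,
        add_sub_cancel, H.knot]
    · refine Or.inr ⟨by linarith, t - T₃, ⟨⟨by linarith, by linarith⟩, ?_⟩, ?_, ?_⟩
      · rw [H.rayDomain_backward]
        exact ⟨by linarith, by linarith⟩
      · exact le_trans (EReal.coe_le_coe_iff.2 (by linarith)) hτ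
      · rw [hF.2, H.backward (t - T₃) (by linarith) (by linarith), add_sub_cancel,
          sub_sub_cancel, H.knot]
  · rintro _ ⟨s, ⟨hs, hhit⟩, rfl⟩
    rw [EReal.coe_le_coe_iff]
    by_contra! hlt
    exact hlt.ne (H.forward_hit hs (by linarith) hhit).1

theorem le_stopForward (H : LassoRays β v T₁ T₂ T₃ T t) (hmid : (T₂ + T₃) / 2 < t) (τ : EReal) :
    ((T - t : ℝ) : EReal) ≤ stopForward v τ := by
  refine le_sInf ?_
  rintro _ ⟨s, ⟨hs, hhit⟩, rfl⟩
  rw [EReal.coe_le_coe_iff]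
  by_contra! hlt
  exact absurd hmid (not_lt.2 (H.forward_hit hs hlt hhit).2)

/-- `hsτ` keeps the relevant part of the forward ray within the lasso. A hit at the knot would then
need `T₂ - t < t - T₃`, strictly because head-on meetings do not count here; this contradicts
`hmid`. -/
theorem backward_hit (H : LassoRays β v T₁ T₂ T₃ T t) (hmid : t ≤ (T₂ + T₃) / 2) {s : ℝ}
    {τ : EReal} (hs : s ∈ rayDomain (-v)) (hsτ : τ ≤ ((T₂ - t : ℝ) : EReal) ∨ s ≤ T₂ - t)
    (hhit : HitsBdry (-v) s ∨ HitsSelf (-v) s ∨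
      ∃ r ∈ Set.Ico 0 s ∩ rayDomain v, (r : EReal) ≤ τ ∧ ray v r = ray (-v) s) :
    s = t - T₁ := by
  have h1 := H.base_lt
  have h2 := H.lt
  have h3 := H.lt_end
  obtain ⟨ht1, ht2⟩ := H.mem
  have hdom := H.rayDomain_backward
  rw [hdom] at hs
  have hray := H.backward s hs.1 hs.2
  rcases hhit with (⟨hpos, hb⟩ | hmax) | ⟨r, hr, heq⟩ | ⟨r, ⟨hr, -⟩, hrτ, heq⟩
  · by_contra hne
    rw [hray] at hb
    have := lt_of_le_of_ne hs.2 hne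
    exact H.notMem_bdry _ ⟨by linarith, by linarith⟩ hb
  · refine le_antisymm hs.2 (hmax _ ?_)
    rw [hdom]
    exact ⟨by linarith, le_rfl⟩
  · rw [hray, H.backward r hr.1 (by linarith [hr.2, hs.2])] at heq
    obtain ⟨e1, e2⟩ := H.eq_knot _ _ (by linarith [hs.2]) (by linarith [hr.2])
      (by linarith [hr.1]) heq.symm
    linarith [hr.1]
  · have hr2 : r ≤ T₂ - t := by
      rcases hsτ with h | h
      · exact EReal.coe_le_coe_iff.1 (hrτ.trans h)
      · linarith [hr.2]
    rw [hray, (H.forward r hr.1 (by linarith)).2] at heq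
    obtain ⟨e1, e2⟩ := H.eq_knot _ _ (by linarith [hs.2]) (by linarith [hr.1, hr.2])
      (by linarith) heq.symm
    linarith [hr.2]

theorem stopBackward_le (H : LassoRays β v T₁ T₂ T₃ T t) (τ : EReal) :
    stopBackward v τ ≤ ((t - T₁ : ℝ) : EReal) := by
  refine sInf_le ⟨t - T₁, ⟨?_, Or.inl (Or.inr fun s hs => ?_)⟩, rfl⟩
  · rw [H.rayDomain_backward]
    exact ⟨by linarith [H.mem.1], le_rfl⟩
  · rw [H.rayDomain_backward] at hs
    exact hs.2

theorem stopBackward_eq (H : LassoRays β v T₁ T₂ T₃ T t) (hmid : t ≤ (T₂ + T₃) / 2) {τ : EReal}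
    (hτ : τ ≤ ((T₂ - t : ℝ) : EReal)) : stopBackward v τ = ((t - T₁ : ℝ) : EReal) := by
  refine le_antisymm (H.stopBackward_le τ) (le_sInf ?_)
  rintro _ ⟨s, ⟨hs, hhit⟩, rfl⟩
  rw [H.backward_hit hmid hs (Or.inl hτ) hhit]

/-- Covers the backward ray stopping first, when no freezing time bounds the forward ray: events
before `T₂ - t` see only forward points within the lasso. -/
theorem stopBackward_eq_of_lt (H : LassoRays β v T₁ T₂ T₃ T t) (hmid : t ≤ (T₂ + T₃) / 2)
    {τ : EReal} (hlt : stopBackward v τ < ((T₂ - t : ℝ) : EReal)) :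
    stopBackward v τ = ((t - T₁ : ℝ) : EReal) := by
  obtain ⟨_, ⟨r, ⟨hr, hrhit⟩, rfl⟩, hrlt⟩ := sInf_lt_iff.1 hlt
  have hrlt' : r < T₂ - t := EReal.coe_lt_coe_iff.1 hrlt
  have hreq := H.backward_hit hmid hr (Or.inr hrlt'.le) hrhit
  refine le_antisymm (H.stopBackward_le τ) (le_sInf ?_)
  rintro _ ⟨s, ⟨hs, hhit⟩, rfl⟩
  rw [EReal.coe_le_coe_iff]
  by_contra! hs'
  exact hs'.ne (H.backward_hit hmid hs (Or.inr (by linarith)) hhit)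

theorem stopTimes_eq (H : LassoRays β v T₁ T₂ T₃ T t) (hmid : t ≤ (T₂ + T₃) / 2) :
    stopTimes v = (((T₂ - t : ℝ) : EReal), ((t - T₁ : ℝ) : EReal)) := by
  have hF := H.stopForward_eq hmid le_top
  rw [stopTimes]
  split_ifs with hle
  · rw [hF, H.stopBackward_eq hmid le_rfl]
  · rw [hF, not_le] at hle
    have hB := H.stopBackward_eq_of_lt hmid hle
    rw [hB, H.stopForward_eq hmid le_rfl]

/-- The bound on the forward ray holds for every freezing time, so the order in which the rays stop
is irrelevant. -/
theorem le_stopTimes_fst (H : LassoRays β v T₁ T₂ T₃ T t) (hmid : (T₂ + T₃) / 2 < t) :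
    ((T - t : ℝ) : EReal) ≤ (stopTimes v).1 := by
  rw [stopTimes]
  split_ifs
  · exact H.le_stopForward hmid _
  · exact H.le_stopForward hmid _

end LassoRays

/-! ### The graph away from the boundary -/

theorem endComponent_subset_bdry (v : TangentVec S) (τ : EReal) : endComponent v τ ⊆ bdry S := by
  rintro q ⟨s, -, -, hq⟩
  exact connectedComponentIn_subset _ _ hq

theorem graph_diff_bdry (v : TangentVec S) :
    graph v \ bdry S = (arc v (stopTimes v).1 ∪ arc (-v) (stopTimes v).2) \ bdry S := by
  ext q
  have h1 := @endComponent_subset_bdry S _ _ v (stopTimes v).1 q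
  have h2 := @endComponent_subset_bdry S _ _ (-v) (stopTimes v).2 q
  simp only [graph, Set.mem_sdiff, Set.mem_union]
  tauto

namespace LassoRays

variable {β : ℝ → S} {v : TangentVec S} {T₁ T₂ T₃ T t : ℝ}

theorem graph_diff_bdry_eq (H : LassoRays β v T₁ T₂ T₃ T t) (hmid : t ≤ (T₂ + T₃) / 2) :
    graph v \ bdry S = β '' Set.Ioc T₁ T₂ := by
  have h3 := H.lt_end
  obtain ⟨ht1, ht2⟩ := H.mem
  rw [graph_diff_bdry, H.stopTimes_eq hmid]
  ext q
  constructor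
  · rintro ⟨⟨s, ⟨hs, hsτ⟩, rfl⟩ | ⟨s, ⟨hs, hsτ⟩, rfl⟩, hq⟩
    · have hs2 : s ≤ T₂ - t := EReal.coe_le_coe_iff.1 hsτ
      have hs0 : 0 ≤ s := hs.1
      rw [(H.forward s hs0 (by linarith)).2] at hq ⊢
      refine ⟨t + s, ⟨lt_of_le_of_ne (by linarith) fun h => hq ?_, by linarith⟩, rfl⟩
      rw [← h]
      exact H.base_mem
    · rw [H.rayDomain_backward] at hs
      rw [H.backward s hs.1 hs.2] at hq ⊢
      refine ⟨t - s, ⟨lt_of_le_of_ne (by linarith [hs.2]) fun h => hq ?_, by linarith [hs.1]⟩, rfl⟩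
      rw [← h]
      exact H.base_mem
  · rintro ⟨x, hx, rfl⟩
    refine ⟨?_, H.notMem_bdry x ⟨hx.1, by linarith [hx.2]⟩⟩
    rcases le_total t x with htx | hxt
    · left
      have hF := H.forward (x - t) (by linarith) (by linarith [hx.2])
      refine ⟨x - t, ⟨hF.1, EReal.coe_le_coe_iff.2 (by linarith [hx.2])⟩, ?_⟩
      rw [hF.2, add_sub_cancel]
    · right
      refine ⟨t - x, ⟨?_, EReal.coe_le_coe_iff.2 (by linarith [hx.1])⟩, ?_⟩
      · rw [H.rayDomain_backward]
        exact ⟨by linarith, by linarith [hx.1]⟩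
      · rw [H.backward _ (by linarith) (by linarith [hx.1]), sub_sub_cancel]

/-- The point `β T` is drawn, but lies off the lasso because `β` has no double point at a time
beyond `T₂`. -/
theorem graph_diff_bdry_ne (H : LassoRays β v T₁ T₂ T₃ T t) (hmid : (T₂ + T₃) / 2 < t) :
    graph v \ bdry S ≠ β '' Set.Ioc T₁ T₂ := by
  have h1 := H.base_lt
  have h2 := H.lt
  have h3 := H.lt_end
  obtain ⟨ht1, ht2⟩ := H.mem
  intro heq
  have hmem : β T ∈ graph v \ bdry S := by
    rw [graph_diff_bdry]
    have hF := H.forward (T - t) (by linarith) le_rfl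
    refine ⟨Or.inl ⟨T - t, ⟨hF.1, H.le_stopTimes_fst hmid⟩, ?_⟩,
      H.notMem_bdry T ⟨by linarith, le_rfl⟩⟩
    rw [hF.2, add_sub_cancel]
  rw [heq] at hmem
  obtain ⟨x, hx, hxT⟩ := hmem
  exact h3.ne' (H.eq_knot x T hx.1.le (hx.2.trans_lt h3) le_rfl hxT).2

end LassoRays

theorem IsPositiveLasso.exists_lassoRays [T2Space S] [HyperbolicSurface S] {α : ℝ → S}
    {T₁ T₂ T₃ t : ℝ} (hα : IsPositiveLasso α T₁ T₂ T₃) (hT : T₁ < T₃)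
    (ht : t ∈ Set.Icc T₁ T₂) :
    ∃ (T : ℝ) (β : ℝ → S), Set.EqOn β α (Set.Icc T₁ T₂) ∧
      LassoRays β (velocity α (Set.Icc T₁ T₂) t) T₁ T₂ T₃ T t := by
  obtain ⟨T, hT2, β, hβα, hβ, hdouble, hbdry⟩ := hα.exists_extension hT
  have hlt := hα.lt
  have h12 : T₁ < T₂ := hT.trans hlt
  have h1T : T₁ < T := h12.trans hT2
  have htT : t ∈ Set.Icc T₁ T := ⟨ht.1, ht.2.trans hT2.le⟩
  have hbase : β T₁ ∈ bdry S := by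
    rw [hβα ⟨le_rfl, h12.le⟩]
    exact hα.base_mem
  refine ⟨T, β, hβα, ?_⟩
  rw [velocity_eq_of_eqOn h12 hT2.le hβ hβα ht]
  exact
    { base_lt := hT
      lt := hlt
      lt_end := hT2
      mem := ht
      forward := fun s hs0 hs =>
        have hr := hβ.isRay_forward h1T htT hs
        ⟨⟨hs0, _, hr⟩, hr.ray_eq hs0⟩
      -- The end point `β T` witnesses that `β` does not lie in the boundary.
      rayDomain_backward := hβ.rayDomain_backward h1T htT hbase
        ⟨h1T.le, le_rfl⟩ (hbdry T ⟨h1T, le_rfl⟩)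
      backward := fun s hs0 hs => (hβ.isRay_backward h1T htT hs).ray_eq hs0
      base_mem := hbase
      notMem_bdry := hbdry
      knot := by rw [hβα ⟨hT.le, hlt.le⟩, hβα ⟨h12.le, le_rfl⟩, hα.knot]
      eq_knot := hdouble }

end

end Hyp

end

theorem proposition4p6 {S : Type*} [TopologicalSpace S] [T2Space S] [CompactSpace S]
    [ChartedSpace Hyp.HalfPlane S] [Hyp.HyperbolicSurface S]
    (α : ℝ → S) (T₁ T₂ T₃ : ℝ) (hα : Hyp.IsPositiveLasso α T₁ T₂ T₃) (hT : T₁ < T₃)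
    (t : ℝ) (ht : t ∈ Set.Icc T₁ T₂) :
    Hyp.graph (Hyp.velocity α (Set.Icc T₁ T₂) t) \ Hyp.bdry S = α '' Set.Ioc T₁ T₂ ↔
      T₁ ≤ t ∧ t ≤ (T₂ + T₃) / 2 := by
  obtain ⟨T, β, hβα, H⟩ := hα.exists_lassoRays hT ht
  rw [← (hβα.mono Set.Ioc_subset_Icc_self).image_eq]
  constructor
  · intro heq
    refine ⟨ht.1, ?_⟩
    by_contra! hmid
    exact H.graph_diff_bdry_ne hmid heq
  · exact fun h => H.graph_diff_bdry_eq h.2
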